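/- **Setting.** Let $(\Omega,\mathcal A,\mathbb P)$ be a probability space with a filtration $(\mathcal F_t)_{t\ge 0}$, write $\mathbb E_{t-1}=\mathbb E[\,\cdot\mid\mathcal F_{t-1}]$ and let $\mathcal B_1=\{\theta\in\mathbb R^d:\|\theta\|_1\le 1\}$. Let $(\ell_t)_{t\ge1}$ be random losses $\mathbb R^d\to\mathbb R$ such that, for every $t\ge 1$, $\ell_t$ is almost surely convex, $\nabla\ell_t(\theta)$ is a subgradient of $\ell_t$ at $\theta$ for $\theta\in\mathcal B_1$, $\ell_t(\theta)$ is integrable for $\theta\in\mathcal B_1$, and $\ell_t$ and $(\omega,\theta)\mapsto\nabla\ell_t(\theta)$ are $\mathcal F_t$-measurable. Assume: * (A1) $\sup_{\theta\in\mathcal B_1}\|\nabla\ell_t(\theta)\|_\infty\le G$ almost surely, for all $t\ge1$; * (A2) $\alpha>0$ and $\beta\in[0,1]$ are such that for all $t\ge 1$ and all $\theta_1,\theta_2\in\mathcal B_1$, almost surely $$\mathbb E_{t-1}[\ell_t(\theta_1)-\ell_t(\theta_2)]\le \mathbb E_{t-1}[\nabla\ell_t(\theta_1)^\top(\theta_1-\theta_2)]-\mathbb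 E_{t-1}\Big[\big(\alpha(\nabla\ell_t(\theta_1)^\top(\theta_1-\theta_2))^2\big)^{1/\beta}\Big],$$ where for $\beta=0$ the power $y^{1/\beta}$ is read as $0$ if $y\le1$ and $+\infty$ if $y>1$. **Algorithm.** Let $T\ge1$ be an integer with $GT\ge e$, let $E=4G/3$, and let $\Theta_0=\{\theta_1,\dots,\theta_K\}\subset\mathcal B_1$ be a $T^{-2}$-cover of $\mathcal B_1$ in $\ell_1$-norm, of minimal cardinality among the covers by points of $\mathcal B_1$. Use the learning rates $\eta_i=(e^iE)^{-1}$, $1\le i\le N$, where either $N=\lfloor\log(ET)\rfloor$ and $G^2T\ge1$, or $N=\lfloor\log(ET^2)\rfloor$. In round $t=1,\dots,T$ predict $\hat\theta_{t-1}=\sum_k\hat\pi_{k,t-1}\theta_k$, where $\hat\pi_{k,0}=1/K$ and $$\hat\pi_{k,t}=\frac{\sum_{i=1}^N\eta_i e^{\eta_i\sum_{s=1}^t(r_{k,s}-\eta_i r_{k,s}^2)}\hat\pi_{k,0}}{\sum_{j=1}^K\sum_{i=1}^N\eta_i e^{\eta_i\sum_{s=1}^t(r_{j,s}-\eta_i r_{j,s}^2)}\hat\pi_{j,0}},\qquad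 r_{k,s}=\nabla\ell_s(\hat\theta_{s-1})^\top(\hat\theta_{s-1}-\theta_k).$$ **Claim.** Let $R_T(\theta)=\frac1T\sum_{t=1}^T\mathbb E_{t-1}[\ell_t(\hat\theta_{t-1})]-\frac1T\sum_{t=1}^T\mathbb E_{t-1}[\ell_t(\theta)]$, let $x>0$ and put $a=d\log T+\log\log(GT)+x$. There is a universal constant $C$ (independent of all the objects above) such that, on an event of probability at least $1-2e^{-x}$, for every $\theta\in\mathcal B_1$, almost surely, $$R_T(\theta)\le C\left(\Big(\frac{a}{\alpha T}\Big)^{\frac1{2-\beta}}+\frac{G}{T^2}+\frac{G\,a}{T}\right),$$ and, if $\alpha G^{2-\beta}\le1$, also $$R_T(\theta)\le C\left(\Big(\frac{a}{\alpha T}\Big)^{\frac1{2-\beta}}+\frac{G}{T^2}\right).$$ -/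

import Mathlib

open MeasureTheory

noncomputable section

/-- The parameter space `ℝ^d`, equipped with the `ℓ₁`-norm. -/
abbrev Param (d : ℕ) : Type := PiLp 1 (fun _ : Fin d => ℝ)

/-- The closed unit ball of the `ℓ₁`-norm. -/
def unitBall (d : ℕ) : Set (Param d) := Metric.closedBall 0 1

/-- The scalar product `gᵀ v`. Gradients live in `Fin d → ℝ`, whose norm is the `ℓ_∞`-norm. -/
def pairing {d : ℕ} (g : Fin d → ℝ) (v : Param d) : ℝ := ∑ i, g i * v i

/-- `g` is a subgradient at `u` of the function `f`. -/
def IsSubgradientAt {d : ℕ} (f : Param d → ℝ) (u : Param d) (g : Fin d → ℝ) : Prop :=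
  ∀ v : Param d, f u + pairing g (v - u) ≤ f v

/-- `Θ₀` is an `ε`-cover of the unit ball, in `ℓ₁`-norm and by points of the ball, of minimal
cardinality. -/
def IsMinimalCover {d : ℕ} (ε : NNReal) (Θ₀ : Finset (Param d)) : Prop :=
  (Θ₀ : Set (Param d)) ⊆ unitBall d ∧
  Metric.IsCover ε (unitBall d) (Θ₀ : Set (Param d)) ∧
  (Θ₀.card : ℕ∞) = Metric.coveringNumber ε (unitBall d)

/-! ### The algorithm (Squint / BOA with `N` constant learning rates) -/

/-- The learning rate `η_i = (e^i E)⁻¹`. -/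
def learningRate (E : ℝ) (i : ℕ) : ℝ := (Real.exp i * E)⁻¹

/-- The unnormalised weight `∑_{i=1}^N η_i exp (η_i (L - η_i Q)) p` of an expert with prior
weight `p`, cumulative linearised regret `L` and cumulative squared linearised regret `Q`. -/
def rawWeight (E : ℝ) (N : ℕ) (p L Q : ℝ) : ℝ :=
  ∑ i ∈ Finset.Icc 1 N,
    learningRate E i * Real.exp (learningRate E i * (L - learningRate E i * Q)) * p

/-- The prediction: the average of the points of the grid for the normalised weights, when `S θ`
is the pair of the cumulative linearised regret and the cumulative squared linearised regret
of `θ`. -/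
def aggregate {d : ℕ} (Θ₀ : Finset (Param d)) (prior : Param d → ℝ) (E : ℝ) (N : ℕ)
    (S : Param d → ℝ × ℝ) : Param d :=
  ∑ θ ∈ Θ₀, (rawWeight E N (prior θ) (S θ).1 (S θ).2 /
    ∑ ϑ ∈ Θ₀, rawWeight E N (prior ϑ) (S ϑ).1 (S ϑ).2) • θ

/-- For each `θ`, the pair `(∑_{s ≤ t} r_s, ∑_{s ≤ t} r_s ^ 2)`, where
`r_s = ∇ℓ_s(θ̂_{s-1})ᵀ (θ̂_{s-1} - θ)` and `grad s` is the gradient oracle `∇ℓ_s`. -/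
def squintState {d : ℕ} (Θ₀ : Finset (Param d)) (prior : Param d → ℝ) (E : ℝ) (N : ℕ)
    (grad : ℕ → Param d → Fin d → ℝ) : ℕ → Param d → ℝ × ℝ
  | 0 => fun _ => (0, 0)
  | t + 1 => fun θ =>
      let S := squintState Θ₀ prior E N grad t
      let p := aggregate Θ₀ prior E N S
      let r := pairing (grad (t + 1) p) (p - θ)
      ((S θ).1 + r, (S θ).2 + r ^ 2)

/-- The prediction `θ̂_t`, computed from the gradients of rounds `1, …, t` and used in
round `t + 1`. -/
def squint {d : ℕ} (Θ₀ : Finset (Param d)) (prior : Param d → ℝ) (E : ℝ) (N : ℕ)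
    (grad : ℕ → Param d → Fin d → ℝ) (t : ℕ) : Param d :=
  aggregate Θ₀ prior E N (squintState Θ₀ prior E N grad t)

/-- The uniform prior on a finite grid. -/
def uniformPrior {d : ℕ} (Θ₀ : Finset (Param d)) : Param d → ℝ := fun _ => 1 / (Θ₀.card : ℝ)

/-! ### The losses, in rounds `t = 1, 2, …` -/

variable {Ω : Type*} {m0 : MeasurableSpace Ω}

/-- `ℓ t ω` is the loss function of round `t ≥ 1`, and `grad t ω θ` a subgradient of it at `θ`.
Here `ℱ t` is the information available at the end of round `t`. -/
structure IsConvexLossSequence (P : Measure Ω) (ℱ : Filtration ℕ m0) {d : ℕ}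
    (ℓ : ℕ → Ω → Param d → ℝ) (grad : ℕ → Ω → Param d → Fin d → ℝ) : Prop where
  loss_adapted : ∀ t, 1 ≤ t → ∀ θ, Measurable[ℱ t] (fun ω => ℓ t ω θ)
  loss_integrable : ∀ t, 1 ≤ t → ∀ θ ∈ unitBall d, Integrable (fun ω => ℓ t ω θ) P
  loss_convex : ∀ t, 1 ≤ t → ∀ᵐ ω ∂P, ConvexOn ℝ Set.univ (ℓ t ω)
  grad_adapted : ∀ t, 1 ≤ t →
    @Measurable (Ω × Param d) (Fin d → ℝ) ((ℱ t).prod inferInstance) inferInstance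
      (fun p => grad t p.1 p.2)
  grad_subgradient : ∀ t, 1 ≤ t → ∀ᵐ ω ∂P, ∀ θ ∈ unitBall d,
    IsSubgradientAt (ℓ t ω) θ (grad t ω θ)

/-- Lipschitz losses: the `ℓ_∞`-norm of the gradients on the unit ball is at most `G`. -/
def LipschitzLoss (P : Measure Ω) {d : ℕ} (grad : ℕ → Ω → Param d → Fin d → ℝ) (G : ℝ) : Prop :=
  ∀ t, 1 ≤ t → ∀ᵐ ω ∂P, ∀ θ ∈ unitBall d, ‖grad t ω θ‖ ≤ G

/-- Weak exp-concavity with parameters `α` and `β`. For `β = 0`, the power `y ^ (1 / β)` is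
read as `0` if `y ≤ 1` and as `+∞` if `y > 1`, so that the inequality forces `y ≤ 1` almost
surely. -/
def WeakExpConcave (P : Measure Ω) (ℱ : Filtration ℕ m0) {d : ℕ}
    (ℓ : ℕ → Ω → Param d → ℝ) (grad : ℕ → Ω → Param d → Fin d → ℝ) (α β : ℝ) : Prop :=
  ∀ t, 1 ≤ t → ∀ θ₁ ∈ unitBall d, ∀ θ₂ ∈ unitBall d,
    (0 < β → ∀ᵐ ω ∂P,
      (P[fun ω' => ℓ t ω' θ₁ - ℓ t ω' θ₂ | ℱ (t - 1)]) ω ≤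
        (P[fun ω' => pairing (grad t ω' θ₁) (θ₁ - θ₂) | ℱ (t - 1)]) ω -
        (P[fun ω' => (α * pairing (grad t ω' θ₁) (θ₁ - θ₂) ^ 2) ^ (1 / β) | ℱ (t - 1)]) ω) ∧
    (β = 0 →
      (∀ᵐ ω ∂P, α * pairing (grad t ω θ₁) (θ₁ - θ₂) ^ 2 ≤ 1) ∧
      ∀ᵐ ω ∂P,
        (P[fun ω' => ℓ t ω' θ₁ - ℓ t ω' θ₂ | ℱ (t - 1)]) ω ≤
          (P[fun ω' => pairing (grad t ω' θ₁) (θ₁ - θ₂) | ℱ (t - 1)]) ω)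

/-- The average risk `R_T(θ)` of the predictions `pred 0, …, pred (T - 1)` (`pred (t - 1)` is
used in round `t`), relative to `θ`. -/
def averageRisk (P : Measure Ω) (ℱ : Filtration ℕ m0) {d : ℕ}
    (ℓ : ℕ → Ω → Param d → ℝ) (pred : ℕ → Ω → Param d) (T : ℕ) (θ : Param d) (ω : Ω) : ℝ :=
  1 / (T : ℝ) * ∑ t ∈ Finset.Icc 1 T, (P[fun ω' => ℓ t ω' (pred (t - 1) ω') | ℱ (t - 1)]) ω -
  1 / (T : ℝ) * ∑ t ∈ Finset.Icc 1 T, (P[fun ω' => ℓ t ω' θ | ℱ (t - 1)]) ω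

/-- The complexity term `d log T + log log (G T) + x`. -/
def complexityTerm (d T : ℕ) (G x : ℝ) : ℝ :=
  d * Real.log T + Real.log (Real.log (G * T)) + x

end

noncomputable section

/-! ### Scalar inequalities -/

/-! Three ingredients are combined. Regret: the potential `squintPotential` never increases, because
`exp (q - q²) ≤ 1 + q` and the prediction is exactly the average that cancels the linear term.
Keeping one summand gives `∑ (η r - (η r)²) ≤ log (N K)` for each grid point and each rate `η`.
Concentration: with `u = η r - 3 (η r)²` and `b = η r - (η r)²`, the inequality `exp (-b) ≤ 1 - u`
makes `exp ∑ (E[u | ℱ] - b)` a supermartingale. Markov's inequality and a union bound over the cover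
give `∑ E[u | ℱ] ≤ ∑ b + log K + x`. Surrogate: the conditional excess loss is at most `E[y - c y²]
+ δ` with `c = 3 η`, either from weak exp-concavity (Young's inequality) or from convexity alone.
This quadratic term is the one in `u`, so dividing by `η T` bounds the risk by `δ + G / T² + (log (N
K) + log K + x) / (η T)`. It remains to choose one deterministic rate. With `ρ = (a / (α T)) ^ (1 /
(2 - β))` the ideal one is `a / (3 T ρ)`. Inside the grid it costs `O(ρ)`, above the grid `O(G a /
T)` is added, and below the grid convexity alone suffices (`exists_learningRate_tradeoff`). One
subtlety: the assumption concerns deterministic points while the predictions are random, and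
gradients need not be continuous. `condExp_surrogate_le` bridges this using monotonicity of
subgradients. -/

theorem exp_sub_sq_le_one_add {q : ℝ} (hq : |q| ≤ 56 / 100) : Real.exp (q - q ^ 2) ≤ 1 + q := by
  obtain ⟨h1, h2⟩ := abs_le.1 hq
  rcases le_total 0 q with h0 | h0
  · have hy : |q - q ^ 2| ≤ 1 := abs_le.2 ⟨by nlinarith, by nlinarith⟩
    have := (abs_le.1 (Real.abs_exp_sub_one_sub_id_le hy)).2
    nlinarith [mul_nonneg (sq_nonneg q) h0, mul_nonneg (mul_nonneg (sq_nonneg q) h0) (by linarith : 0 ≤ 2 - q)]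
  -- For negative `q` a second-order bound is too weak up to 0.56, so a fourth-order Taylor bound is
  -- used; `hw` is what remains after division by `p²`.
  · obtain ⟨p, rfl⟩ : ∃ p, q = -p := ⟨-q, by ring⟩
    have hp0 : 0 ≤ p := by linarith
    have hp1 : p ≤ 56 / 100 := by linarith
    have hy : |-p - (-p) ^ 2| ≤ 1 := abs_le.2 ⟨by nlinarith, by nlinarith⟩
    have h := (abs_le.1 (Real.exp_bound hy (n := 4) (by norm_num))).2
    have h4 : |-p - (-p) ^ 2| ^ 4 = (p + p ^ 2) ^ 4 := by
      rw [← abs_neg, abs_of_nonneg (by nlinarith)]; ring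
    rw [h4] at h
    simp only [Finset.sum_range_succ, Finset.sum_range_zero, Nat.factorial] at h
    norm_num at h
    have hw : (1 + p) ^ 2 / 2 - p * (1 + p) ^ 3 / 6 + 5 * p ^ 2 * (1 + p) ^ 4 / 96 ≤ 1 := by
      have e1 : p * (1 + p) ≤ 8736 / 10000 := by nlinarith
      have e2 : 0 ≤ p * (1 + p) ^ 3 := by positivity
      have e3 : p ^ 2 * (1 + p) ^ 4 ≤ 8736 / 10000 * (p * (1 + p) ^ 3) := by nlinarith
      have e4 : (1 + p) ^ 2 / 2 - 12 / 100 * (p * (1 + p) ^ 3) ≤ 1 := by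
        nlinarith [mul_nonneg hp0 (by linarith : 0 ≤ 56 / 100 - p), sq_nonneg p, pow_nonneg hp0 3,
          pow_nonneg hp0 4]
      linarith
    rw [neg_sq]
    linarith [mul_le_mul_of_nonneg_left hw (sq_nonneg p)]

/-- This is `exp (-b) ≤ 1 - u` for the supermartingale; it follows from `exp y ≤ 1 + y + y²` at `y =
-q + q²`. -/
theorem exp_neg_add_sq_le {q : ℝ} (hq : |q| ≤ 1 / 10) :
    Real.exp (-q + q ^ 2) ≤ 1 - (q - 3 * q ^ 2) := by
  obtain ⟨h1, h2⟩ := abs_le.1 hq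
  have hy : |-q + q ^ 2| ≤ 1 := abs_le.2 ⟨by nlinarith, by nlinarith⟩
  have := (abs_le.1 (Real.abs_exp_sub_one_sub_id_le hy)).2
  have h3 : (1 - q) ^ 2 ≤ 2 := by nlinarith
  nlinarith [mul_le_mul_of_nonneg_left h3 (sq_nonneg q)]

/-- A form of Young's inequality: a power dominates a linear function up to a constant. -/
theorem mul_le_rpow_one_div_add {z κ ρ β : ℝ} (hz : 0 ≤ z) (hρ : 0 < ρ) (hβ : 0 < β) (hβ1 : β ≤ 1)
    (hκ : κ ≤ ρ ^ (1 - β)) : κ * z ≤ z ^ (1 / β) + ρ := by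
  rcases le_total z (ρ ^ β) with h | h
  · calc κ * z ≤ ρ ^ (1 - β) * z := by gcongr
      _ ≤ ρ ^ (1 - β) * ρ ^ β := by gcongr
      _ = ρ := by rw [← Real.rpow_add hρ]; simp
      _ ≤ _ := by have := Real.rpow_nonneg hz (1 / β); linarith
  · have hz' : 0 < z := (Real.rpow_pos_of_pos hρ β).trans_le h
    have h0 : 0 ≤ 1 / β - 1 := by
      rw [sub_nonneg, le_div_iff₀ hβ]; linarith
    have h1 : ρ ^ (1 - β) ≤ z ^ (1 / β - 1) := by
      calc ρ ^ (1 - β) = (ρ ^ β) ^ (1 / β - 1) := by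
            rw [← Real.rpow_mul hρ.le]; congr 1; field_simp
        _ ≤ _ := Real.rpow_le_rpow (by positivity) h h0
    calc κ * z ≤ z ^ (1 / β - 1) * z := by gcongr; exact hκ.trans h1
      _ = z ^ (1 / β) := by rw [← Real.rpow_add_one hz'.ne']; congr 1; ring
      _ ≤ _ := by linarith

/-- Monotonicity of `y ↦ y - c y²` in the range `c |y| ≤ 1/4`, in a quantitative form. -/
theorem sub_mul_sq_le_add {c y y' e : ℝ} (hy : |c * y| ≤ 1 / 4)
    (hy' : |c * y'| ≤ 1 / 4) (he : 0 ≤ e) (h : y' ≤ y + e) :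
    y' - c * y' ^ 2 ≤ y - c * y ^ 2 + 2 * e := by
  obtain ⟨h1, h2⟩ := abs_le.1 hy
  obtain ⟨h3, h4⟩ := abs_le.1 hy'
  have h5 : y - c * y ^ 2 - (y' - c * y' ^ 2) = (y - y') * (1 - (c * y + c * y')) := by ring
  have h6 : 0 ≤ 1 - (c * y + c * y') := by linarith
  have h7 : 1 - (c * y + c * y') ≤ 2 := by linarith
  nlinarith [mul_le_mul_of_nonneg_left h7 he, mul_le_mul_of_nonneg_right (by linarith : -e ≤ y - y') h6]

/-! ### Covers of the unit ball -/

/-- Volume comparison: the balls of radius `ε / 2` around the points are disjoint and lie in a ball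
of radius `1 + ε / 2`. -/
theorem Metric.card_le_of_isSeparated_closedBall {E : Type*} [NormedAddCommGroup E]
    [NormedSpace ℝ E] [FiniteDimensional ℝ E] {ε : NNReal} (hε : 0 < ε) (s : Finset E)
    (hs : (s : Set E) ⊆ Metric.closedBall 0 1) (h : Metric.IsSeparated ε (s : Set E)) :
    (s.card : ℝ) ≤ (1 + 2 / ε) ^ Module.finrank ℝ E := by
  borelize E
  let μ : Measure E := Measure.addHaar
  let δ : ℝ := ε / 2
  let ρ : ℝ := 1 + ε / 2
  have hε' : (0 : ℝ) < ε := hε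
  have δpos : 0 < δ := by positivity
  have ρpos : 0 < ρ := by positivity
  set A := ⋃ c ∈ s, Metric.ball (c : E) δ with hA
  have D : Set.Pairwise (s : Set E) (Function.onFun Disjoint fun c => Metric.ball (c : E) δ) := by
    rintro c hc d hd hcd
    apply Metric.ball_disjoint_ball
    have h1 : (ε : ENNReal) < edist c d := h hc hd hcd
    rw [edist_nndist, ENNReal.coe_lt_coe] at h1
    have h2 : (ε : ℝ) < dist c d := h1
    simp only [δ]; linarith
  have A_subset : A ⊆ Metric.ball (0 : E) ρ := by
    refine Set.iUnion₂_subset fun x hx => Metric.ball_subset_ball' ?_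
    have : dist x 0 ≤ 1 := hs hx
    simp only [δ, ρ]; linarith
  have I : (s.card : ENNReal) * ENNReal.ofReal (δ ^ Module.finrank ℝ E) * μ (Metric.ball 0 1) ≤
      ENNReal.ofReal (ρ ^ Module.finrank ℝ E) * μ (Metric.ball 0 1) :=
    calc
      _ = μ A := by
        rw [hA, measure_biUnion_finset D fun c _ => Metric.isOpen_ball.measurableSet]
        simp only [μ.addHaar_ball_of_pos _ δpos]
        simp only [Finset.sum_const, nsmul_eq_mul, mul_assoc]
      _ ≤ μ (Metric.ball (0 : E) ρ) := measure_mono A_subset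
      _ = _ := by simp only [μ.addHaar_ball_of_pos _ ρpos]
  have J := (ENNReal.mul_le_mul_iff_left
    (Metric.measure_ball_pos μ (0 : E) zero_lt_one).ne' measure_ball_lt_top.ne).1 I
  have K := ENNReal.toReal_le_of_le_ofReal (pow_nonneg ρpos.le _) J
  rw [ENNReal.toReal_mul, ENNReal.toReal_natCast, ENNReal.toReal_ofReal (by positivity)] at K
  have hδρ : ρ = (1 + 2 / ε) * δ := by simp only [δ, ρ]; field_simp; ring
  rw [hδρ, mul_pow] at K
  exact le_of_mul_le_mul_right K (by positivity)

theorem Metric.coveringNumber_closedBall_le {E : Type*} [NormedAddCommGroup E]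
    [NormedSpace ℝ E] [FiniteDimensional ℝ E] {ε : NNReal} (hε : 0 < ε) :
    Metric.coveringNumber ε (Metric.closedBall (0 : E) 1) ≤
      (⌊(1 + 2 / (ε : ℝ)) ^ Module.finrank ℝ E⌋₊ : ℕ) := by
  refine (Metric.coveringNumber_le_packingNumber _ _).trans ?_
  refine iSup_le fun C => iSup₂_le fun hC hsep => ?_
  by_contra! hlt
  -- A separated set is not known to be finite, so the volume bound is applied to a finite subset
  -- with one point too many.
  obtain ⟨t, htC, ht⟩ := Set.exists_subset_encard_eq (Order.add_one_le_of_lt hlt)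
  have hfin : t.Finite := Set.finite_of_encard_eq_coe (k := _ + 1) (by rw [ht]; push_cast; rfl)
  have h1 := Metric.card_le_of_isSeparated_closedBall hε hfin.toFinset
    (by simpa using htC.trans hC) (by rw [hfin.coe_toFinset]; exact Set.Pairwise.mono htC hsep)
  have h2 := Nat.le_floor h1
  rw [hfin.encard_eq_coe_toFinset_card] at ht
  have h3 : hfin.toFinset.card = ⌊(1 + 2 / (ε : ℝ)) ^ Module.finrank ℝ E⌋₊ + 1 := by
    exact_mod_cast ht
  omega

theorem IsMinimalCover.nonempty {d : ℕ} {ε : NNReal} {Θ₀ : Finset (Param d)}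
    (h : IsMinimalCover ε Θ₀) : Θ₀.Nonempty := by
  have := h.2.1.nonempty (s := unitBall d) ⟨0, by simp [unitBall]⟩
  exact_mod_cast this

theorem IsMinimalCover.exists_norm_sub_le {d : ℕ} {ε : NNReal} {Θ₀ : Finset (Param d)}
    (h : IsMinimalCover ε Θ₀) {θ : Param d} (hθ : θ ∈ unitBall d) :
    ∃ ϑ ∈ Θ₀, ‖ϑ - θ‖ ≤ ε := by
  obtain ⟨ϑ, hϑ, h1⟩ := h.2.1 hθ
  refine ⟨ϑ, hϑ, ?_⟩
  have h1 : edist θ ϑ ≤ ε := h1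
  rw [edist_nndist, ENNReal.coe_le_coe] at h1
  rw [← dist_eq_norm, dist_comm]
  exact h1

theorem IsMinimalCover.card_le {d T : ℕ} (hT : 1 ≤ T) {Θ₀ : Finset (Param d)}
    (h : IsMinimalCover (((T : NNReal) ^ 2)⁻¹) Θ₀) :
    (Θ₀.card : ℝ) ≤ (1 + 2 * (T : ℝ) ^ 2) ^ d := by
  have hT' : (0 : NNReal) < (T : NNReal) := by exact_mod_cast hT
  have h1 : (Θ₀.card : ℕ∞) ≤ _ :=
    h.2.2.le.trans (Metric.coveringNumber_closedBall_le (E := Param d) (by positivity))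
  have h2 := (Nat.le_floor_iff (by positivity)).1 (Nat.cast_le.1 h1)
  have h3 : Module.finrank ℝ (Param d) = d := by
    rw [(WithLp.linearEquiv 1 ℝ (Fin d → ℝ)).finrank_eq]; simp
  rw [h3] at h2
  refine h2.trans (le_of_eq ?_)
  push_cast
  field_simp

/-! ### Deterministic analysis of the algorithm -/

theorem pairing_add {d : ℕ} (g : Fin d → ℝ) (u v : Param d) :
    pairing g (u + v) = pairing g u + pairing g v := by
  simp [pairing, mul_add, Finset.sum_add_distrib]

theorem pairing_smul {d : ℕ} (g : Fin d → ℝ) (c : ℝ) (v : Param d) :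
    pairing g (c • v) = c * pairing g v := by
  simp only [pairing, PiLp.smul_apply, smul_eq_mul, Finset.mul_sum]
  exact Finset.sum_congr rfl fun i _ => by ring

/-- `pairing g` as a linear map. -/
def pairingLinear {d : ℕ} (g : Fin d → ℝ) : Param d →ₗ[ℝ] ℝ where
  toFun := pairing g
  map_add' := pairing_add g
  map_smul' := pairing_smul g

theorem pairing_sub {d : ℕ} (g : Fin d → ℝ) (u v : Param d) :
    pairing g (u - v) = pairing g u - pairing g v :=
  map_sub (pairingLinear g) u v

theorem pairing_sum {d : ℕ} {ι : Type*} (g : Fin d → ℝ) (s : Finset ι) (f : ι → Param d) :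
    pairing g (∑ i ∈ s, f i) = ∑ i ∈ s, pairing g (f i) :=
  map_sum (pairingLinear g) f s

theorem abs_pairing_le {d : ℕ} {g : Fin d → ℝ} {G : ℝ} (hg : ‖g‖ ≤ G) (v : Param d) :
    |pairing g v| ≤ G * ‖v‖ := by
  have hG : 0 ≤ G := (norm_nonneg g).trans hg
  rw [PiLp.norm_eq_of_L1, Finset.mul_sum]
  refine (Finset.abs_sum_le_sum_abs _ _).trans (Finset.sum_le_sum fun i _ => ?_)
  rw [abs_mul, Real.norm_eq_abs]
  gcongr
  exact (norm_le_pi_norm g i).trans hg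

theorem mem_unitBall {d : ℕ} {θ : Param d} : θ ∈ unitBall d ↔ ‖θ‖ ≤ 1 := by
  simp [unitBall]

theorem norm_sub_le_of_mem_unitBall {d : ℕ} {u v : Param d} (hu : u ∈ unitBall d)
    (hv : v ∈ unitBall d) : ‖u - v‖ ≤ 2 := by
  rw [mem_unitBall] at hu hv
  linarith [norm_sub_le u v]

theorem learningRate_pos {E : ℝ} (hE : 0 < E) (i : ℕ) : 0 < learningRate E i := by
  unfold learningRate; positivity

theorem rawWeight_pos {E : ℝ} (hE : 0 < E) {N : ℕ} (hN : 1 ≤ N) {p : ℝ} (hp : 0 < p) (L Q : ℝ) :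
    0 < rawWeight E N p L Q := by
  refine Finset.sum_pos (fun i _ => ?_) ⟨1, by simp [hN]⟩
  have := learningRate_pos hE i
  positivity

section Squint

variable {d : ℕ} {Θ₀ : Finset (Param d)} {prior : Param d → ℝ} {E : ℝ} {N : ℕ}

theorem sum_rawWeight_pos (hΘ : Θ₀.Nonempty) (hp : ∀ θ, 0 < prior θ) (hE : 0 < E) (hN : 1 ≤ N)
    (S : Param d → ℝ × ℝ) : 0 < ∑ ϑ ∈ Θ₀, rawWeight E N (prior ϑ) (S ϑ).1 (S ϑ).2 :=
  Finset.sum_pos (fun θ _ => rawWeight_pos hE hN (hp θ) _ _) hΘ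

theorem aggregate_mem_unitBall (hΘ : Θ₀.Nonempty) (hball : (Θ₀ : Set (Param d)) ⊆ unitBall d)
    (hp : ∀ θ, 0 < prior θ) (hE : 0 < E) (hN : 1 ≤ N) (S : Param d → ℝ × ℝ) :
    aggregate Θ₀ prior E N S ∈ unitBall d := by
  have hZ := sum_rawWeight_pos hΘ hp hE hN S
  refine (convex_closedBall (0 : Param d) 1).sum_mem (fun θ _ => ?_) ?_ fun θ hθ => hball hθ
  · have := rawWeight_pos hE hN (hp θ) (S θ).1 (S θ).2
    positivity
  · rw [← Finset.sum_div, div_self hZ.ne']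

/-- The raw weights carry the factor `η_i`, and the prediction is their barycentre, so the
first-order change of the potential vanishes whatever the gradient. -/
theorem sum_rawWeight_mul_pairing (hΘ : Θ₀.Nonempty) (hp : ∀ θ, 0 < prior θ) (hE : 0 < E)
    (hN : 1 ≤ N) (S : Param d → ℝ × ℝ) (g : Fin d → ℝ) :
    ∑ θ ∈ Θ₀, rawWeight E N (prior θ) (S θ).1 (S θ).2 *
      pairing g (aggregate Θ₀ prior E N S - θ) = 0 := by
  have hZ := sum_rawWeight_pos hΘ hp hE hN S
  simp only [pairing_sub, mul_sub, Finset.sum_sub_distrib, ← Finset.sum_mul]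
  rw [aggregate, pairing_sum, Finset.mul_sum, sub_eq_zero]
  refine Finset.sum_congr rfl fun θ _ => ?_
  rw [pairing_smul]
  field_simp

/-- The linearised regret of `θ` in round `t + 1`. -/
def instantRegret (Θ₀ : Finset (Param d)) (prior : Param d → ℝ) (E : ℝ) (N : ℕ)
    (grad : ℕ → Param d → Fin d → ℝ) (t : ℕ) (θ : Param d) : ℝ :=
  pairing (grad (t + 1) (squint Θ₀ prior E N grad t)) (squint Θ₀ prior E N grad t - θ)

theorem squintState_eq_sum (grad : ℕ → Param d → Fin d → ℝ) (t : ℕ) (θ : Param d) :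
    squintState Θ₀ prior E N grad t θ =
      (∑ s ∈ Finset.range t, instantRegret Θ₀ prior E N grad s θ,
        ∑ s ∈ Finset.range t, instantRegret Θ₀ prior E N grad s θ ^ 2) := by
  induction t with
  | zero => simp [squintState]
  | succ t ih =>
    rw [Finset.sum_range_succ, Finset.sum_range_succ]
    simp only [squintState]
    rw [ih]
    rfl

/-- The total weight of the algorithm's experts, before multiplication by the learning rates. -/
def squintPotential (Θ₀ : Finset (Param d)) (prior : Param d → ℝ) (E : ℝ) (N : ℕ)
    (S : Param d → ℝ × ℝ) : ℝ :=
  ∑ θ ∈ Θ₀, ∑ i ∈ Finset.Icc 1 N,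
    prior θ * Real.exp (learningRate E i * ((S θ).1 - learningRate E i * (S θ).2))

/-- Each summand is multiplied by `exp (q - q²) ≤ 1 + q` with `q = η_i r`; the terms in `q` sum to
zero. -/
theorem squintPotential_succ_le (hΘ : Θ₀.Nonempty) (hp : ∀ θ, 0 < prior θ) (hE : 0 < E)
    (hN : 1 ≤ N) (grad : ℕ → Param d → Fin d → ℝ) (t : ℕ)
    (hr : ∀ θ ∈ Θ₀, ∀ i, 1 ≤ i →
      |learningRate E i * instantRegret Θ₀ prior E N grad t θ| ≤ 56 / 100) :
    squintPotential Θ₀ prior E N (squintState Θ₀ prior E N grad (t + 1)) ≤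
      squintPotential Θ₀ prior E N (squintState Θ₀ prior E N grad t) := by
  set S := squintState Θ₀ prior E N grad t with hS
  have key : ∀ θ ∈ Θ₀, ∑ i ∈ Finset.Icc 1 N, prior θ * Real.exp (learningRate E i *
      ((squintState Θ₀ prior E N grad (t + 1) θ).1 -
        learningRate E i * (squintState Θ₀ prior E N grad (t + 1) θ).2)) ≤
      ∑ i ∈ Finset.Icc 1 N,
        prior θ * Real.exp (learningRate E i * ((S θ).1 - learningRate E i * (S θ).2)) +
      rawWeight E N (prior θ) (S θ).1 (S θ).2 * instantRegret Θ₀ prior E N grad t θ := by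
    intro θ hθ
    rw [rawWeight, Finset.sum_mul, ← Finset.sum_add_distrib]
    refine Finset.sum_le_sum fun i hi => ?_
    have h1 := exp_sub_sq_le_one_add (hr θ hθ i (Finset.mem_Icc.1 hi).1)
    have h2 : squintState Θ₀ prior E N grad (t + 1) θ =
      ((S θ).1 + instantRegret Θ₀ prior E N grad t θ,
        (S θ).2 + instantRegret Θ₀ prior E N grad t θ ^ 2) := rfl
    rw [h2]
    set η := learningRate E i
    set r := instantRegret Θ₀ prior E N grad t θ
    have h3 : η * ((S θ).1 + r - η * ((S θ).2 + r ^ 2)) =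
      η * ((S θ).1 - η * (S θ).2) + (η * r - (η * r) ^ 2) := by ring
    rw [h3, Real.exp_add]
    have h4 := mul_le_mul_of_nonneg_left h1
      (mul_nonneg (hp θ).le (Real.exp_pos (η * ((S θ).1 - η * (S θ).2))).le)
    linarith
  calc _ ≤ _ := Finset.sum_le_sum key
    _ = squintPotential Θ₀ prior E N S := by
      rw [Finset.sum_add_distrib]
      have := sum_rawWeight_mul_pairing hΘ hp hE hN S
        (grad (t + 1) (squint Θ₀ prior E N grad t))
      simp only [instantRegret]
      rw [squint, ← hS] at this ⊢
      rw [this, add_zero]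
      rfl

/-- The second-order regret bound of the algorithm. -/
theorem learningRate_mul_sum_instantRegret_le (hΘ : Θ₀.Nonempty) (hE : 0 < E)
    (hN : 1 ≤ N) (grad : ℕ → Param d → Fin d → ℝ) (T : ℕ)
    (hr : ∀ t < T, ∀ θ ∈ Θ₀, ∀ i, 1 ≤ i →
      |learningRate E i * instantRegret Θ₀ (uniformPrior Θ₀) E N grad t θ| ≤ 56 / 100)
    {θ : Param d} (hθ : θ ∈ Θ₀) {i : ℕ} (hi : i ∈ Finset.Icc 1 N) :
    ∑ t ∈ Finset.range T, (learningRate E i * instantRegret Θ₀ (uniformPrior Θ₀) E N grad t θ -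
      (learningRate E i * instantRegret Θ₀ (uniformPrior Θ₀) E N grad t θ) ^ 2) ≤
      Real.log (N * Θ₀.card) := by
  have hK : (0 : ℝ) < Θ₀.card := by exact_mod_cast hΘ.card_pos
  have hp : ∀ θ, 0 < uniformPrior Θ₀ θ := fun θ => by unfold uniformPrior; positivity
  -- The initial potential is `N`: the prior sums to one and each of the `N` rates contributes a
  -- copy.
  have hW : ∀ t ≤ T, squintPotential Θ₀ (uniformPrior Θ₀) E N
      (squintState Θ₀ (uniformPrior Θ₀) E N grad t) ≤ N := by
    intro t
    induction t with
    | zero =>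
      intro _
      simp only [squintPotential, squintState, uniformPrior]
      simp
      field_simp
      exact le_rfl
    | succ t ih =>
      intro ht
      exact (squintPotential_succ_le hΘ hp hE hN grad t (hr t (by omega))).trans (ih (by omega))
  have h1 := hW T le_rfl
  rw [squintPotential] at h1
  have h2 := (Finset.single_le_sum (f := fun θ => ∑ i ∈ Finset.Icc 1 N, uniformPrior Θ₀ θ *
      Real.exp (learningRate E i * ((squintState Θ₀ (uniformPrior Θ₀) E N grad T θ).1 -
        learningRate E i * (squintState Θ₀ (uniformPrior Θ₀) E N grad T θ).2)))
      (fun θ _ => Finset.sum_nonneg fun i _ => by have := hp θ; positivity) hθ).trans h1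
  have h3 := (Finset.single_le_sum (f := fun i => uniformPrior Θ₀ θ *
      Real.exp (learningRate E i * ((squintState Θ₀ (uniformPrior Θ₀) E N grad T θ).1 -
        learningRate E i * (squintState Θ₀ (uniformPrior Θ₀) E N grad T θ).2)))
      (fun i _ => by have := hp θ; positivity) hi).trans h2
  simp only [uniformPrior, squintState_eq_sum] at h3
  rw [Real.le_log_iff_exp_le (by
    have : 1 ≤ N := hN
    positivity)]
  rw [Finset.sum_sub_distrib]
  simp only [mul_pow, ← Finset.mul_sum]
  rw [one_div, inv_mul_le_iff₀ hK] at h3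
  refine le_trans (le_of_eq ?_) (h3.trans_eq (mul_comm _ _))
  congr 1
  unfold uniformPrior
  ring

/-! ### Measurability of the predictions -/

variable {Ω : Type*} {m0 : MeasurableSpace Ω}

theorem measurable_pairing {m : MeasurableSpace Ω} {g : Ω → Fin d → ℝ} {v : Ω → Param d}
    (hg : Measurable g) (hv : Measurable v) : Measurable fun ω => pairing (g ω) (v ω) := by
  unfold pairing
  refine Finset.measurable_sum _ fun i _ => ?_
  have h1 : Measurable fun ω => g ω i := (measurable_pi_apply i).comp hg
  have h2 : Measurable fun ω => v ω i :=
    (measurable_pi_apply i).comp ((WithLp.measurable_ofLp 1 (Fin d → ℝ)).comp hv)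
  exact h1.mul h2

theorem measurable_pairing_sub_const {m : MeasurableSpace Ω} {g : Ω → Fin d → ℝ}
    {v : Ω → Param d} (hg : Measurable g) (hv : Measurable v) (θ : Param d) :
    Measurable fun ω => pairing (g ω) (v ω - θ) :=
  measurable_pairing hg (hv.sub_const θ)

theorem measurable_add_add_sq {m : MeasurableSpace Ω} {f : Ω → ℝ × ℝ} {r : Ω → ℝ}
    (hf : Measurable f) (hr : Measurable r) :
    Measurable fun ω => ((f ω).1 + r ω, (f ω).2 + r ω ^ 2) := by
  fun_prop

theorem measurable_aggregate {m : MeasurableSpace Ω} {S : Ω → Param d → ℝ × ℝ}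
    (hS : ∀ θ, Measurable fun ω => S ω θ) :
    Measurable fun ω => aggregate Θ₀ prior E N (S ω) := by
  have hw : ∀ θ, Measurable fun ω => rawWeight E N (prior θ) (S ω θ).1 (S ω θ).2 := by
    intro θ
    have := hS θ
    unfold rawWeight
    fun_prop
  unfold aggregate
  refine Finset.measurable_sum _ fun θ _ => ?_
  exact ((hw θ).div (Finset.measurable_sum _ fun ϑ _ => hw ϑ)).smul_const θ

/-- The gradient is evaluated at a random prediction, so the induction rests on its joint
measurability in `(ω, θ)`. -/
theorem measurable_squintState {ℱ : Filtration ℕ m0} {grad : ℕ → Ω → Param d → Fin d → ℝ}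
    (hgrad : ∀ t, 1 ≤ t →
      @Measurable (Ω × Param d) (Fin d → ℝ) ((ℱ t).prod inferInstance) inferInstance
        (fun p => grad t p.1 p.2)) (t : ℕ) (θ : Param d) :
    Measurable[ℱ t] fun ω => squintState Θ₀ prior E N (fun s => grad s ω) t θ := by
  induction t generalizing θ with
  | zero => exact measurable_const
  | succ t ih =>
    have h1 : ∀ θ, Measurable[ℱ (t + 1)]
        fun ω => squintState Θ₀ prior E N (fun s => grad s ω) t θ :=
      fun θ => (ih θ).mono (ℱ.mono (Nat.le_succ t)) le_rfl
    have h2 : Measurable[ℱ (t + 1)]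
        fun ω => aggregate Θ₀ prior E N (squintState Θ₀ prior E N (fun s => grad s ω) t) :=
      measurable_aggregate (m := ℱ (t + 1)) h1
    have h3 : Measurable[ℱ (t + 1)] fun ω => grad (t + 1) ω
        (aggregate Θ₀ prior E N (squintState Θ₀ prior E N (fun s => grad s ω) t)) :=
      (hgrad (t + 1) (by omega)).comp (measurable_id.prodMk h2)
    have h4 := measurable_pairing_sub_const (m := ℱ (t + 1)) h3 h2 θ
    exact measurable_add_add_sq (m := ℱ (t + 1)) (h1 θ) h4

theorem measurable_squint {ℱ : Filtration ℕ m0} {grad : ℕ → Ω → Param d → Fin d → ℝ}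
    (hgrad : ∀ t, 1 ≤ t →
      @Measurable (Ω × Param d) (Fin d → ℝ) ((ℱ t).prod inferInstance) inferInstance
        (fun p => grad t p.1 p.2)) (t : ℕ) :
    Measurable[ℱ t] fun ω => squint Θ₀ prior E N (fun s => grad s ω) t :=
  measurable_aggregate (m := ℱ t) (measurable_squintState hgrad t)

theorem measurable_instantRegret {ℱ : Filtration ℕ m0} {grad : ℕ → Ω → Param d → Fin d → ℝ}
    (hgrad : ∀ t, 1 ≤ t →
      @Measurable (Ω × Param d) (Fin d → ℝ) ((ℱ t).prod inferInstance) inferInstance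
        (fun p => grad t p.1 p.2)) (t : ℕ) (θ : Param d) :
    Measurable[ℱ (t + 1)] fun ω => instantRegret Θ₀ prior E N (fun s => grad s ω) t θ := by
  have h2 := (measurable_squint (Θ₀ := Θ₀) (prior := prior) (E := E) (N := N) hgrad t).mono
    (ℱ.mono (Nat.le_succ t)) le_rfl
  exact measurable_pairing_sub_const (m := ℱ (t + 1))
    ((hgrad (t + 1) (by omega)).comp (measurable_id.prodMk h2)) h2 θ

end Squint

/-! ### An exponential supermartingale -/

section Supermartingale

variable {Ω : Type*} {m0 : MeasurableSpace Ω} {P : Measure Ω}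
  {ℱ : Filtration ℕ m0}

/-- The process `∏_{s < t} exp (E[u_s | ℱ_s] - b_s)`, written as the exponential of a sum. -/
def expSupermartingale (P : Measure Ω) (ℱ : Filtration ℕ m0) (u b : ℕ → Ω → ℝ) (t : ℕ) (ω : Ω) : ℝ :=
  Real.exp (∑ s ∈ Finset.range t, ((P[u s | ℱ s]) ω - b s ω))

theorem stronglyMeasurable_expSupermartingale {u b : ℕ → Ω → ℝ}
    (hb : ∀ t, Measurable[ℱ (t + 1)] (b t)) (t : ℕ) :
    StronglyMeasurable[ℱ t] (expSupermartingale P ℱ u b t) := by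
  refine Real.continuous_exp.comp_stronglyMeasurable ?_
  refine Finset.stronglyMeasurable_fun_sum _ fun s hs => ?_
  have hst : s + 1 ≤ t := Finset.mem_range.1 hs
  exact (stronglyMeasurable_condExp.mono (ℱ.mono (by omega))).sub
    ((hb s).stronglyMeasurable.mono (ℱ.mono hst))

theorem ae_abs_condExp_sub_le {u b : ℕ → Ω → ℝ} {B : ℝ}
    (hbB : ∀ t, ∀ᵐ ω ∂P, |b t ω| ≤ B) (huB : ∀ t, ∀ᵐ ω ∂P, |u t ω| ≤ B) (t : ℕ) :
    ∀ᵐ ω ∂P, |(P[u t | ℱ t]) ω - b t ω| ≤ 2 * B := by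
  filter_upwards [hbB t, ae_bdd_abs_condExp_of_ae_bdd_abs (m := ℱ t) (huB t)] with ω h1 h2
  have := abs_sub ((P[u t | ℱ t]) ω) (b t ω)
  linarith

theorem ae_norm_expSupermartingale_le {u b : ℕ → Ω → ℝ} {B : ℝ}
    (hbB : ∀ t, ∀ᵐ ω ∂P, |b t ω| ≤ B) (huB : ∀ t, ∀ᵐ ω ∂P, |u t ω| ≤ B) (t : ℕ) :
    ∀ᵐ ω ∂P, ‖expSupermartingale P ℱ u b t ω‖ ≤ Real.exp (t * (2 * B)) := by
  filter_upwards [ae_all_iff.2 (ae_abs_condExp_sub_le (ℱ := ℱ) hbB huB)] with ω h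
  rw [expSupermartingale, Real.norm_eq_abs, Real.abs_exp, Real.exp_le_exp]
  calc _ ≤ ∑ s ∈ Finset.range t, 2 * B := Finset.sum_le_sum fun s _ => (le_abs_self _).trans (h s)
    _ = _ := by simp

theorem integrable_expSupermartingale [IsProbabilityMeasure P] {u b : ℕ → Ω → ℝ} {B : ℝ}
    (hb : ∀ t, Measurable[ℱ (t + 1)] (b t))
    (hbB : ∀ t, ∀ᵐ ω ∂P, |b t ω| ≤ B) (huB : ∀ t, ∀ᵐ ω ∂P, |u t ω| ≤ B) (t : ℕ) :
    Integrable (expSupermartingale P ℱ u b t) P :=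
  .of_bound ((stronglyMeasurable_expSupermartingale hb t).mono (ℱ.le t)).aestronglyMeasurable _
    (ae_norm_expSupermartingale_le hbB huB t)

/-- Conditionally on `ℱ t`, the new factor has mean at most `exp c * (1 - c) ≤ 1`, where `c = E[u |
ℱ t]`. -/
theorem integral_expSupermartingale_le_one [IsProbabilityMeasure P] {u b : ℕ → Ω → ℝ} {B : ℝ}
    (hb : ∀ t, Measurable[ℱ (t + 1)] (b t)) (hu : ∀ t, Integrable (u t) P)
    (hbB : ∀ t, ∀ᵐ ω ∂P, |b t ω| ≤ B) (huB : ∀ t, ∀ᵐ ω ∂P, |u t ω| ≤ B)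
    (hub : ∀ t, ∀ᵐ ω ∂P, Real.exp (-b t ω) ≤ 1 - u t ω) (t : ℕ) :
    ∫ ω, expSupermartingale P ℱ u b t ω ∂P ≤ 1 := by
  induction t with
  | zero => simp [expSupermartingale]
  | succ t ih =>
    refine le_trans ?_ ih
    set c := P[u t | ℱ t] with hc
    let f : Ω → ℝ := fun ω => expSupermartingale P ℱ u b t ω * Real.exp (c ω)
    let g : Ω → ℝ := fun ω => Real.exp (-b t ω)
    have hfg : expSupermartingale P ℱ u b (t + 1) = f * g := by
      ext ω
      simp only [expSupermartingale, Finset.sum_range_succ, Pi.mul_apply, f, g, ← Real.exp_add]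
      congr 1; ring
    have hf : StronglyMeasurable[ℱ t] f := (stronglyMeasurable_expSupermartingale hb t).mul
      (Real.continuous_exp.comp_stronglyMeasurable stronglyMeasurable_condExp)
    have hg : Integrable g P := by
      refine .of_bound (C := Real.exp B) ?_ ?_
      · exact (Real.measurable_exp.comp
          ((hb t).mono (ℱ.le _) le_rfl).neg).aestronglyMeasurable
      · filter_upwards [hbB t] with ω h
        rw [Real.norm_eq_abs, Real.abs_exp, Real.exp_le_exp]
        linarith [(abs_le.1 h).1]
    have hint := integrable_expSupermartingale hb hbB huB (ℱ := ℱ)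
    have hint' := hint (t + 1)
    rw [hfg] at hint'
    have hpull := condExp_mul_of_stronglyMeasurable_left hf hint' hg
    have hgc : P[g | ℱ t] ≤ᵐ[P] fun ω => 1 - c ω := by
      have h1 := condExp_mono (m := ℱ t) hg ((integrable_const (1 : ℝ)).sub (hu t)) (hub t)
      have h2 := condExp_sub (integrable_const (1 : ℝ)) (hu t) (ℱ t)
      have h3 := condExp_const (μ := P) (ℱ.le t) (1 : ℝ)
      filter_upwards [h1, h2] with ω h1 h2
      refine h1.trans (le_of_eq ?_)
      rw [h2, Pi.sub_apply, h3]
    rw [hfg, ← integral_condExp (ℱ.le t) (f := f * g)]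
    refine integral_mono_ae integrable_condExp (hint t) ?_
    filter_upwards [hpull, hgc] with ω h1 h2
    rw [h1, Pi.mul_apply]
    have h3 : 0 < expSupermartingale P ℱ u b t ω := Real.exp_pos _
    have h4 : Real.exp (c ω) * (P[g | ℱ t]) ω ≤ 1 := by
      have h5 : 1 - c ω ≤ Real.exp (-c ω) := by linarith [Real.add_one_le_exp (-c ω)]
      calc _ ≤ Real.exp (c ω) * Real.exp (-c ω) := by gcongr; exact h2.trans h5
        _ = 1 := by rw [← Real.exp_add]; simp
    calc _ = expSupermartingale P ℱ u b t ω * (Real.exp (c ω) * (P[g | ℱ t]) ω) := by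
          simp only [f]; ring
      _ ≤ _ := mul_le_of_le_one_right h3.le h4

/-- With high probability, simultaneously for finitely many pairs of processes `u`, `b` with
`exp (-b) ≤ 1 - u`, the sum of the conditional expectations of `u` is not much larger than the sum
of `b`. -/
theorem exists_event_sum_condExp_sub_le [IsProbabilityMeasure P] {ι : Type*} {s : Finset ι} (hs : s.Nonempty)
    {u b : ι → ℕ → Ω → ℝ} {B : ℝ}
    (hb : ∀ k ∈ s, ∀ t, Measurable[ℱ (t + 1)] (b k t))
    (hu : ∀ k ∈ s, ∀ t, Integrable (u k t) P)
    (hbB : ∀ k ∈ s, ∀ t, ∀ᵐ ω ∂P, |b k t ω| ≤ B) (huB : ∀ k ∈ s, ∀ t, ∀ᵐ ω ∂P, |u k t ω| ≤ B)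
    (hub : ∀ k ∈ s, ∀ t, ∀ᵐ ω ∂P, Real.exp (-b k t ω) ≤ 1 - u k t ω) (T : ℕ) (x : ℝ) :
    ∃ A : Set Ω, MeasurableSet A ∧ 1 - Real.exp (-x) ≤ P.real A ∧ ∀ ω ∈ A, ∀ k ∈ s,
      ∑ t ∈ Finset.range T, ((P[u k t | ℱ t]) ω - b k t ω) ≤ Real.log s.card + x := by
  have hK : (0 : ℝ) < s.card := by exact_mod_cast hs.card_pos
  -- The level `card * exp x` makes each exceptional set have probability at most `exp (-x) / card`,
  -- ready for the union bound.
  let D : ι → Set Ω := fun k => {ω | s.card * Real.exp x ≤ expSupermartingale P ℱ (u k) (b k) T ω}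
  have hDm : ∀ k ∈ s, MeasurableSet (D k) := fun k hk =>
    measurableSet_le measurable_const
      ((stronglyMeasurable_expSupermartingale (hb k hk) T).mono (ℱ.le T)).measurable
  have hD : ∀ k ∈ s, P.real (D k) ≤ Real.exp (-x) / s.card := by
    intro k hk
    have h1 := mul_meas_ge_le_integral_of_nonneg (μ := P)
      (Filter.Eventually.of_forall fun ω => (Real.exp_pos _).le)
      (integrable_expSupermartingale (hb k hk) (hbB k hk) (huB k hk) T) (s.card * Real.exp x)
    have h2 := h1.trans
      (integral_expSupermartingale_le_one (hb k hk) (hu k hk) (hbB k hk) (huB k hk) (hub k hk) T)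
    rw [Real.exp_neg, le_div_iff₀ hK, inv_eq_one_div, le_div_iff₀ (Real.exp_pos x)]
    calc _ = s.card * Real.exp x * P.real (D k) := by ring
      _ ≤ 1 := h2
  refine ⟨(⋃ k ∈ s, D k)ᶜ, (Finset.measurableSet_biUnion s hDm).compl, ?_, ?_⟩
  · rw [probReal_compl_eq_one_sub (Finset.measurableSet_biUnion s hDm)]
    have h1 := measureReal_biUnion_finset_le (μ := P) s D
    have h2 : ∑ k ∈ s, P.real (D k) ≤ Real.exp (-x) :=
      (Finset.sum_le_sum hD).trans_eq (by simp; field_simp)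
    linarith
  · intro ω hω k hk
    have h1 : ω ∉ D k := fun h => hω (Set.mem_biUnion hk h)
    have h2 : expSupermartingale P ℱ (u k) (b k) T ω < s.card * Real.exp x := not_le.1 h1
    rw [expSupermartingale, ← Real.lt_log_iff_exp_lt (by positivity), Real.log_mul hK.ne'
      (Real.exp_pos x).ne', Real.log_exp] at h2
    exact h2.le

end Supermartingale

/-! ### Conditional inequalities at random points -/

theorem unitBall_convex (d : ℕ) : Convex ℝ (unitBall d) := convex_closedBall 0 1

/-- Rounding to a finite net replaces a random point by one with finitely many values, where
pointwise almost sure statements can be combined. -/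
theorem exists_measurable_finite_approx (d : ℕ) {ε : ℝ} (hε : 0 < ε) :
    ∃ s : Finset (Param d), (s : Set (Param d)) ⊆ unitBall d ∧ ∃ φ : Param d → Param d,
      Measurable φ ∧ (∀ θ, φ θ ∈ s) ∧ ∀ θ ∈ unitBall d, ‖φ θ - θ‖ ≤ ε := by
  obtain ⟨t, htball, htfin, htcov⟩ :=
    (isCompact_closedBall (0 : Param d) 1).finite_cover_balls hε
  have hne : t.Nonempty := by
    have h0 : (0 : Param d) ∈ Metric.closedBall (0 : Param d) 1 := by simp
    obtain ⟨y, hy, -⟩ := Set.mem_iUnion₂.1 (htcov h0)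
    exact ⟨y, hy⟩
  obtain ⟨e, he⟩ := htfin.countable.exists_eq_range hne
  have hidx : ∀ v ∈ t, ∃ k, e k = v := by rw [he]; exact fun v hv => hv
  choose! k hk using hidx
  -- Large enough that all points of the net occur among the first `M + 1` terms of the enumeration.
  set M := htfin.toFinset.sup k
  refine ⟨htfin.toFinset, by rw [htfin.coe_toFinset]; exact htball, SimpleFunc.nearestPt e M,
    SimpleFunc.measurable _, fun θ => ?_, fun θ hθ => ?_⟩
  · rw [htfin.mem_toFinset, he]
    exact ⟨_, rfl⟩
  · obtain ⟨v, hv, hvθ⟩ := Set.mem_iUnion₂.1 (htcov hθ)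
    have h1 : k v ≤ M := Finset.le_sup (htfin.mem_toFinset.2 hv)
    have h2 := SimpleFunc.edist_nearestPt_le e θ h1
    rw [hk v hv, edist_dist, edist_dist, ENNReal.ofReal_le_ofReal_iff dist_nonneg] at h2
    rw [← dist_eq_norm]
    exact h2.trans (by rw [dist_comm]; exact (Metric.mem_ball.1 hvθ).le)

section OneRound

variable {Ω : Type*} {m m0 : MeasurableSpace Ω} {P : Measure Ω} {d : ℕ}

theorem eq_sum_indicator {H : Ω → Param d → ℝ} {s : Finset (Param d)} {ψ : Ω → Param d}
    (hψs : ∀ ω, ψ ω ∈ s) :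
    (fun ω => H ω (ψ ω)) = ∑ v ∈ s, (ψ ⁻¹' {v}).indicator fun ω => H ω v := by
  ext ω
  rw [Finset.sum_apply, Finset.sum_eq_single_of_mem (ψ ω) (hψs ω)]
  · simp
  · intro v _ hv
    exact Set.indicator_of_notMem (by simpa using Ne.symm hv) _

theorem integrable_comp_of_finite {H : Ω → Param d → ℝ} {s : Finset (Param d)} {ψ : Ω → Param d}
    (hψ : Measurable ψ) (hψs : ∀ ω, ψ ω ∈ s)
    (hH : ∀ v ∈ s, Integrable (fun ω => H ω v) P) : Integrable (fun ω => H ω (ψ ω)) P := by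
  rw [eq_sum_indicator hψs]
  exact integrable_finsetSum' _ fun v hv =>
    (hH v hv).indicator (hψ (measurableSet_singleton v))

/-- The events `ψ = v` belong to the conditioning `σ`-algebra, so their indicators come out of the
conditional expectation. -/
theorem condExp_comp_le_of_finite (hm : m ≤ m0) {H : Ω → Param d → ℝ}
    {s : Finset (Param d)} {ψ : Ω → Param d} (hψ : Measurable[m] ψ) (hψs : ∀ ω, ψ ω ∈ s)
    (hH : ∀ v ∈ s, Integrable (fun ω => H ω v) P) {δ : ℝ}
    (hδ : ∀ v ∈ s, ∀ᵐ ω ∂P, (P[fun ω' => H ω' v | m]) ω ≤ δ) :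
    ∀ᵐ ω ∂P, (P[fun ω' => H ω' (ψ ω') | m]) ω ≤ δ := by
  have hms : ∀ v, MeasurableSet[m] (ψ ⁻¹' {v}) := fun v => hψ (measurableSet_singleton v)
  rw [eq_sum_indicator hψs]
  have h1 := condExp_finsetSum (μ := P) (s := s)
    (f := fun v => (ψ ⁻¹' {v}).indicator fun ω => H ω v)
    (fun v hv => (hH v hv).indicator (hm _ (hms v))) m
  have h2 : ∀ᵐ ω ∂P, ∀ v ∈ s, (P[(ψ ⁻¹' {v}).indicator fun ω => H ω v | m]) ω =
      (ψ ⁻¹' {v}).indicator (P[fun ω => H ω v | m]) ω :=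
    (Finset.eventually_all s).2 fun v hv => condExp_indicator (hH v hv) (hms v)
  filter_upwards [h1, h2, (Finset.eventually_all s).2 hδ] with ω h1 h2 h3
  rw [h1, Finset.sum_apply, Finset.sum_congr rfl h2,
    Finset.sum_eq_single_of_mem (ψ ω) (hψs ω)]
  · rw [Set.indicator_of_mem (by simp)]
    exact h3 _ (hψs ω)
  · intro v _ hv
    exact Set.indicator_of_notMem (by simpa using Ne.symm hv) _

theorem loss_sub_le {f : Param d → ℝ} {g : Param d → Fin d → ℝ} {G : ℝ}
    (hsub : ∀ θ ∈ unitBall d, IsSubgradientAt f θ (g θ)) (hG : ∀ θ ∈ unitBall d, ‖g θ‖ ≤ G)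
    {u v : Param d} (hu : u ∈ unitBall d) : f u - f v ≤ G * ‖u - v‖ := by
  have h1 := hsub u hu v
  have h2 := (abs_le.1 (abs_pairing_le (hG u hu) (v - u))).1
  rw [norm_sub_rev] at h2
  linarith

/-- Comparison of the surrogate `f u - f w - (y - c y²)`, `y = ∇f(u)ᵀ(u - w)`, at a point `p`
of the ball and at a point `ψ` close to `p + κ (w - p)`. -/
theorem surrogate_le_surrogate_add {f : Param d → ℝ} {g : Param d → Fin d → ℝ} {G c κ : ℝ}
    (hsub : ∀ θ ∈ unitBall d, IsSubgradientAt f θ (g θ)) (hG : ∀ θ ∈ unitBall d, ‖g θ‖ ≤ G)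
    (hc : 0 ≤ c) (hcG : c * (2 * G) ≤ 1 / 4) (hκ : 0 < κ) (hκ1 : κ ≤ 1)
    {p ψ w : Param d} (hp : p ∈ unitBall d) (hψ : ψ ∈ unitBall d) (hw : w ∈ unitBall d)
    (hψp : ‖ψ - (p + κ • (w - p))‖ ≤ κ ^ 2) :
    f p - f w - (pairing (g p) (p - w) - c * pairing (g p) (p - w) ^ 2) ≤
      f ψ - f w - (pairing (g ψ) (ψ - w) - c * pairing (g ψ) (ψ - w) ^ 2) + 13 * G * κ := by
  have hG0 : 0 ≤ G := (norm_nonneg _).trans (hG p hp)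
  have hbound : ∀ {u : Param d}, u ∈ unitBall d → |pairing (g u) (u - w)| ≤ 2 * G := by
    intro u hu
    have := abs_pairing_le (hG u hu) (u - w)
    have := mul_le_mul_of_nonneg_left (norm_sub_le_of_mem_unitBall hu hw) hG0
    linarith
  have hcb : ∀ {u : Param d}, u ∈ unitBall d → |c * pairing (g u) (u - w)| ≤ 1 / 4 := by
    intro u hu
    rw [abs_mul, abs_of_nonneg hc]
    exact (mul_le_mul_of_nonneg_left (hbound hu) hc).trans hcG
  set e := ψ - (p + κ • (w - p)) with he
  have hψe : ψ - p = e - κ • (p - w) := by rw [he]; module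
  have hdist : ‖ψ - p‖ ≤ 3 * κ := by
    rw [hψe]
    refine (norm_sub_le _ _).trans ?_
    rw [norm_smul, Real.norm_of_nonneg hκ.le]
    have := mul_le_mul_of_nonneg_left (norm_sub_le_of_mem_unitBall hp hw) hκ.le
    nlinarith
  have h1 : f p - f ψ ≤ G * (3 * κ) := by
    refine (loss_sub_le hsub hG hp).trans ?_
    rw [norm_sub_rev]
    gcongr
  -- Subgradients are monotone: up to `e`, `ψ` is `p` moved by `κ` towards `w`. The error `‖e‖ ≤ κ²`
  -- stays of order `κ` after division by `κ`.
  have h2 : pairing (g ψ) (p - w) ≤ pairing (g p) (p - w) + 2 * G * κ := by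
    have h3 := hsub p hp ψ
    have h4 := hsub ψ hψ p
    rw [← neg_sub ψ p, ← neg_one_smul ℝ, pairing_smul] at h4
    rw [hψe, pairing_sub, pairing_smul] at h3 h4
    have h5 := (abs_le.1 (abs_pairing_le (hG p hp) e)).1
    have h6 := (abs_le.1 (abs_pairing_le (hG ψ hψ) e)).2
    have h7 := mul_le_mul_of_nonneg_left hψp hG0
    have h8 : κ * pairing (g ψ) (p - w) ≤ κ * (pairing (g p) (p - w) + 2 * G * κ) := by
      linarith
    exact le_of_mul_le_mul_left h8 hκ
  have h3 : pairing (g ψ) (ψ - w) ≤ pairing (g p) (p - w) + 5 * G * κ := by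
    have h4 : ψ - w = (p - w) + (ψ - p) := by abel
    have h5 := (abs_le.1 (abs_pairing_le (hG ψ hψ) (ψ - p))).2
    have h6 := mul_le_mul_of_nonneg_left hdist hG0
    rw [h4, pairing_add]
    linarith
  -- The increment `5 G κ` is doubled here; with `3 G κ` from `h1` this makes `13 G κ`.
  have h4 := sub_mul_sq_le_add (hcb hp) (hcb hψ) (by positivity) h3
  linarith

/-- The properties of the loss of one round that are used in the analysis. -/
structure IsLipschitzConvexLoss (P : Measure Ω) (L : Ω → Param d → ℝ)
    (g : Ω → Param d → Fin d → ℝ) (G : ℝ) : Prop where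
  integrable : ∀ θ ∈ unitBall d, Integrable (fun ω => L ω θ) P
  measurable_grad : Measurable fun q : Ω × Param d => g q.1 q.2
  subgradient : ∀ᵐ ω ∂P, ∀ θ ∈ unitBall d, IsSubgradientAt (L ω) θ (g ω θ)
  norm_grad_le : ∀ᵐ ω ∂P, ∀ θ ∈ unitBall d, ‖g ω θ‖ ≤ G

namespace IsLipschitzConvexLoss

variable {L : Ω → Param d → ℝ} {g : Ω → Param d → Fin d → ℝ} {G : ℝ}

theorem ae_abs_pairing_le (h : IsLipschitzConvexLoss P L g G) :
    ∀ᵐ ω ∂P, ∀ u ∈ unitBall d, ∀ w ∈ unitBall d, |pairing (g ω u) (u - w)| ≤ 2 * G := by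
  filter_upwards [h.norm_grad_le] with ω hG u hu w hw
  have hG0 : 0 ≤ G := (norm_nonneg _).trans (hG u hu)
  have := abs_pairing_le (hG u hu) (u - w)
  have := mul_le_mul_of_nonneg_left (norm_sub_le_of_mem_unitBall hu hw) hG0
  linarith

theorem measurable_regret (h : IsLipschitzConvexLoss P L g G) {p : Ω → Param d} (hp : Measurable p)
    (w : Param d) : Measurable fun ω => pairing (g ω (p ω)) (p ω - w) :=
  measurable_pairing_sub_const (h.measurable_grad.comp (measurable_id.prodMk hp)) hp w

theorem integrable_regret_sub_sq [IsFiniteMeasure P] (h : IsLipschitzConvexLoss P L g G)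
    {p : Ω → Param d} (hp : Measurable p) (hpb : ∀ ω, p ω ∈ unitBall d) {w : Param d}
    (hw : w ∈ unitBall d) (c : ℝ) :
    Integrable (fun ω => pairing (g ω (p ω)) (p ω - w) -
      c * pairing (g ω (p ω)) (p ω - w) ^ 2) P := by
  have hm := h.measurable_regret hp w
  refine .of_bound (C := 2 * G + |c| * (2 * G) ^ 2)
    (hm.sub ((hm.pow_const 2).const_mul c)).aestronglyMeasurable ?_
  filter_upwards [h.ae_abs_pairing_le] with ω hω
  have h1 := hω _ (hpb ω) w hw
  refine (norm_sub_le _ _).trans ?_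
  rw [norm_mul, norm_pow, Real.norm_eq_abs, Real.norm_eq_abs]
  gcongr

/-- Integrability is assumed only at fixed points. The loss is almost surely Lipschitz on the ball,
so its value at `p` is a limit of values at finite-valued approximations, which also gives
measurability. -/
theorem integrable_comp [IsFiniteMeasure P] (h : IsLipschitzConvexLoss P L g G)
    {p : Ω → Param d} (hp : Measurable p) (hpb : ∀ ω, p ω ∈ unitBall d) :
    Integrable (fun ω => L ω (p ω)) P := by
  have hε : ∀ n : ℕ, (0 : ℝ) < 1 / ((n : ℝ) + 1) := fun n => by positivity
  choose s hs φ hφ hφs hφε using fun n : ℕ => exists_measurable_finite_approx d (hε n)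
  have hint : ∀ n, Integrable (fun ω => L ω (φ n (p ω))) P := fun n =>
    integrable_comp_of_finite (s := s n) ((hφ n).comp hp) (fun ω => hφs n _)
      fun v hv => h.integrable v (hs n hv)
  have hclose : ∀ᵐ ω ∂P, ∀ n : ℕ, |L ω (φ n (p ω)) - L ω (p ω)| ≤ G * (1 / ((n : ℝ) + 1)) := by
    filter_upwards [h.subgradient, h.norm_grad_le] with ω hsub hG n
    have hG0 : 0 ≤ G := (norm_nonneg _).trans (hG _ (hpb ω))
    have h1 := loss_sub_le hsub hG (v := p ω) (hs n (hφs n (p ω)))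
    have h2 := loss_sub_le hsub hG (v := φ n (p ω)) (hpb ω)
    have h3 := mul_le_mul_of_nonneg_left (hφε n _ (hpb ω)) hG0
    rw [norm_sub_rev] at h2
    exact abs_le.2 ⟨by linarith, by linarith⟩
  have hmeas : AEStronglyMeasurable (fun ω => L ω (p ω)) P := by
    refine aestronglyMeasurable_of_tendsto_ae Filter.atTop
      (fun n => (hint n).aestronglyMeasurable) ?_
    filter_upwards [hclose] with ω hω
    rw [tendsto_iff_norm_sub_tendsto_zero]
    refine squeeze_zero (fun n => norm_nonneg _) hω ?_
    simpa using tendsto_one_div_add_atTop_nhds_zero_nat.const_mul G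
  have hdiff : Integrable (fun ω => L ω (p ω) - L ω (φ 0 (p ω))) P := by
    refine .of_bound (C := G) (hmeas.sub (hint 0).aestronglyMeasurable) ?_
    filter_upwards [hclose] with ω hω
    simpa [abs_sub_comm] using hω 0
  exact (hdiff.add (hint 0)).congr (.of_forall fun ω => by simp)

/-- A conditional inequality that holds at all points of the ball also holds at random points that
are measurable with respect to the conditioning `σ`-algebra. -/
theorem condExp_surrogate_le [IsProbabilityMeasure P] (h : IsLipschitzConvexLoss P L g G)
    (hm : m ≤ m0) {c δ : ℝ} (hc : 0 ≤ c) (hcG : c * (2 * G) ≤ 1 / 4) {w : Param d}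
    (hw : w ∈ unitBall d)
    (hδ : ∀ θ ∈ unitBall d, ∀ᵐ ω ∂P, (P[fun ω' => L ω' θ - L ω' w -
      (pairing (g ω' θ) (θ - w) - c * pairing (g ω' θ) (θ - w) ^ 2) | m]) ω ≤ δ)
    {p : Ω → Param d} (hp : Measurable[m] p) (hpb : ∀ ω, p ω ∈ unitBall d) :
    ∀ᵐ ω ∂P, (P[fun ω' => L ω' (p ω') - L ω' w -
      (pairing (g ω' (p ω')) (p ω' - w) - c * pairing (g ω' (p ω')) (p ω' - w) ^ 2) | m]) ω ≤ δ := by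
  let H : Ω → Param d → ℝ := fun ω θ => L ω θ - L ω w -
      (pairing (g ω θ) (θ - w) - c * pairing (g ω θ) (θ - w) ^ 2)
  have hp0 : Measurable p := hp.mono hm le_rfl
  have hHint : ∀ {q : Ω → Param d}, Measurable q → (∀ ω, q ω ∈ unitBall d) →
      Integrable (fun ω => H ω (q ω)) P := fun hq hqb =>
    ((h.integrable_comp hq hqb).sub (h.integrable w hw)).sub
      (h.integrable_regret_sub_sq hq hqb hw c)
  have key : ∀ n : ℕ, ∀ᵐ ω ∂P, (P[fun ω' => H ω' (p ω') | m]) ω ≤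
      δ + 13 * G * (1 / ((n : ℝ) + 1)) := by
    intro n
    set κ : ℝ := 1 / ((n : ℝ) + 1) with hκ
    have hκ0 : 0 < κ := by positivity
    have hκ1 : κ ≤ 1 := by
      rw [hκ, div_le_one (by positivity)]; linarith [(Nat.cast_nonneg n : (0 : ℝ) ≤ n)]
    obtain ⟨s, hs, φ, hφ, hφs, hφε⟩ := exists_measurable_finite_approx d (pow_pos hκ0 2)
    -- The point is pushed towards `w` before being rounded at scale `κ²`; rounding `p` itself would
    -- give no control on the gradient.
    let q : Ω → Param d := fun ω => p ω + κ • (w - p ω)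
    have hq : Measurable[m] q :=
      (show Measurable fun v : Param d => v + κ • (w - v) by fun_prop).comp hp
    have hqb : ∀ ω, q ω ∈ unitBall d := fun ω =>
      (unitBall_convex d).add_smul_sub_mem (hpb ω) hw ⟨hκ0.le, hκ1⟩
    have hψ : Measurable[m] fun ω => φ (q ω) := hφ.comp hq
    have hψb : ∀ ω, φ (q ω) ∈ unitBall d := fun ω => hs (hφs _)
    have hψint := hHint (hψ.mono hm le_rfl) hψb
    have h1 := condExp_comp_le_of_finite (H := H) hm hψ (fun ω => hφs _)
      (fun v hv => hHint (q := fun _ => v) measurable_const fun _ => hs hv)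
      (fun v hv => hδ v (hs hv))
    have h2 := condExp_mono (m := m) (hHint hp0 hpb)
      (hψint.add (integrable_const (13 * G * κ))) (by
        filter_upwards [h.subgradient, h.norm_grad_le] with ω hsub hG
        exact surrogate_le_surrogate_add hsub hG hc hcG hκ0 hκ1 (hpb ω) (hψb ω) hw
          (hφε _ (hqb ω)))
    have h3 := condExp_add hψint (integrable_const (μ := P) (13 * G * κ)) m
    have h4 := condExp_const (μ := P) hm (13 * G * κ)
    filter_upwards [h1, h2, h3] with ω h1 h2 h3
    rw [h3, Pi.add_apply, h4] at h2
    linarith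
  filter_upwards [ae_all_iff.2 key] with ω hω
  have hlim : Filter.Tendsto (fun n : ℕ => δ + 13 * G * (1 / ((n : ℝ) + 1))) Filter.atTop
      (nhds (δ + 13 * G * 0)) :=
    (tendsto_one_div_add_atTop_nhds_zero_nat.const_mul _).const_add _
  rw [mul_zero, add_zero] at hlim
  exact ge_of_tendsto' hlim hω

end IsLipschitzConvexLoss

end OneRound

theorem IsConvexLossSequence.isLipschitzConvexLoss {Ω : Type*} {m0 : MeasurableSpace Ω}
    {P : Measure Ω} {ℱ : Filtration ℕ m0} {d : ℕ} {ℓ : ℕ → Ω → Param d → ℝ}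
    {grad : ℕ → Ω → Param d → Fin d → ℝ} {G : ℝ} (h : IsConvexLossSequence P ℱ ℓ grad)
    (hG : LipschitzLoss P grad G) {t : ℕ} (ht : 1 ≤ t) :
    IsLipschitzConvexLoss P (ℓ t) (grad t) G where
  integrable := h.loss_integrable t ht
  measurable_grad := (h.grad_adapted t ht).mono (sup_le_sup
    (MeasurableSpace.comap_mono (ℱ.le t)) le_rfl) le_rfl
  subgradient := h.grad_subgradient t ht
  norm_grad_le := hG t ht

/-! ### Risk bounds in terms of a surrogate inequality -/

section CondExp

variable {Ω : Type*} {m m0 : MeasurableSpace Ω} {P : Measure Ω} [IsProbabilityMeasure P]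

theorem condExp_le_const (hm : m ≤ m0) {F : Ω → ℝ} (hF : Integrable F P) {δ : ℝ}
    (h : ∀ᵐ ω ∂P, F ω ≤ δ) : ∀ᵐ ω ∂P, (P[F | m]) ω ≤ δ := by
  have h1 := condExp_mono (m := m) hF (integrable_const δ) h
  rwa [condExp_const hm] at h1

theorem condExp_sub_le_const (hm : m ≤ m0) {F Y Z Q : Ω → ℝ} (hF : Integrable F P)
    (hY : Integrable Y P) (hZ : Integrable Z P) (hQ : Integrable Q P) {ρ : ℝ}
    (h : ∀ᵐ ω ∂P, (P[F | m]) ω ≤ (P[Y | m]) ω - (P[Z | m]) ω)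
    (hYQ : ∀ᵐ ω ∂P, Y ω - Z ω ≤ Q ω + ρ) :
    ∀ᵐ ω ∂P, (P[fun ω' => F ω' - Q ω' | m]) ω ≤ ρ := by
  have h1 := condExp_mono (m := m) (hY.sub hZ) (hQ.add (integrable_const ρ)) hYQ
  have h2 := condExp_const (μ := P) hm ρ
  filter_upwards [h, h1, condExp_sub hY hZ m, condExp_add hQ (integrable_const ρ) m,
    condExp_sub hF hQ m] with ω h h1 h3 h4 h5
  rw [h3, h4, Pi.sub_apply, Pi.add_apply, h2] at h1
  have h6 : (P[fun ω' => F ω' - Q ω' | m]) ω = (P[F | m]) ω - (P[Q | m]) ω := h5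
  linarith

end CondExp

section Risk

variable {Ω : Type*} {m0 : MeasurableSpace Ω} {P : Measure Ω} [IsProbabilityMeasure P]
  {ℱ : Filtration ℕ m0} {d : ℕ} {ℓ : ℕ → Ω → Param d → ℝ} {grad : ℕ → Ω → Param d → Fin d → ℝ}
  {G : ℝ}

/-- The inequality `E_t[ℓ(θ₁) - ℓ(θ₂)] ≤ E_t[y - c y²] + δ`, where `y = ∇ℓ(θ₁)ᵀ(θ₁ - θ₂)`. -/
def SurrogateBound (P : Measure Ω) (ℱ : Filtration ℕ m0) (ℓ : ℕ → Ω → Param d → ℝ)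
    (grad : ℕ → Ω → Param d → Fin d → ℝ) (c δ : ℝ) : Prop :=
  ∀ t, ∀ θ₁ ∈ unitBall d, ∀ θ₂ ∈ unitBall d, ∀ᵐ ω ∂P,
    (P[fun ω' => ℓ (t + 1) ω' θ₁ - ℓ (t + 1) ω' θ₂ -
      (pairing (grad (t + 1) ω' θ₁) (θ₁ - θ₂) -
        c * pairing (grad (t + 1) ω' θ₁) (θ₁ - θ₂) ^ 2) | ℱ t]) ω ≤ δ

/-- The subgradient inequality bounds the loss difference by `y`, and `c y² ≤ 4 c G²`. This serves
when the ideal rate lies below the grid. -/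
theorem SurrogateBound.of_convex (hℓ : IsConvexLossSequence P ℱ ℓ grad)
    (hG : LipschitzLoss P grad G) {c : ℝ} (hc : 0 ≤ c) :
    SurrogateBound P ℱ ℓ grad c (4 * c * G ^ 2) := by
  intro t θ₁ h₁ θ₂ h₂
  have hL := hℓ.isLipschitzConvexLoss hG (t := t + 1) (by omega)
  refine condExp_le_const (ℱ.le t) (((hL.integrable θ₁ h₁).sub (hL.integrable θ₂ h₂)).sub
    (hL.integrable_regret_sub_sq (p := fun _ => θ₁) measurable_const (fun _ => h₁) h₂ c)) ?_
  filter_upwards [hL.subgradient, hL.ae_abs_pairing_le] with ω hsub hb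
  have h3 := hsub θ₁ h₁ θ₂
  rw [← neg_sub θ₁ θ₂, ← neg_one_smul ℝ, pairing_smul] at h3
  have h4 : pairing (grad (t + 1) ω θ₁) (θ₁ - θ₂) ^ 2 ≤ (2 * G) ^ 2 :=
    sq_le_sq' (by linarith [(abs_le.1 (hb θ₁ h₁ θ₂ h₂)).1]) (abs_le.1 (hb θ₁ h₁ θ₂ h₂)).2
  have h5 := mul_le_mul_of_nonneg_left h4 hc
  simp only [Pi.sub_apply]
  linarith

/-- Young's inequality with `z = α y²` and `κ = c / α` trades the power in the assumption for the
quadratic term `c y²`, at cost `ρ`. -/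
theorem SurrogateBound.of_weakExpConcave (hℓ : IsConvexLossSequence P ℱ ℓ grad)
    (hG : LipschitzLoss P grad G) {α β : ℝ} (hα : 0 < α) (hβ : 0 ≤ β) (hβ1 : β ≤ 1)
    (h : WeakExpConcave P ℱ ℓ grad α β) {c ρ : ℝ} (hc : 0 ≤ c) (hρ : 0 < ρ)
    (hcρ : c / α ≤ ρ ^ (1 - β)) : SurrogateBound P ℱ ℓ grad c ρ := by
  intro t θ₁ h₁ θ₂ h₂
  have hL := hℓ.isLipschitzConvexLoss hG (t := t + 1) (by omega)
  have hF := (hL.integrable θ₁ h₁).sub (hL.integrable θ₂ h₂)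
  have hQ := hL.integrable_regret_sub_sq (p := fun _ => θ₁) measurable_const (fun _ => h₁) h₂
  have hY := hQ 0
  simp only [zero_mul, sub_zero] at hY
  have hcα : ∀ y : ℝ, c * y ^ 2 = c / α * (α * y ^ 2) := fun y => by field_simp
  obtain ⟨hpos, hzero⟩ := h (t + 1) (by omega) θ₁ h₁ θ₂ h₂
  rcases hβ.eq_or_lt with rfl | hβ0
  -- For `β = 0` the power vanishes and `α y² ≤ 1`, so `c y² ≤ c / α ≤ ρ`.
  · obtain ⟨hz1, hz2⟩ := hzero rfl
    refine condExp_sub_le_const (ℱ.le t) hF hY (integrable_zero _ _ _) (hQ c) (Z := fun _ => 0)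
      ?_ ?_
    · have h0 : P[fun _ : Ω => (0 : ℝ) | ℱ t] = fun _ => 0 := condExp_const (ℱ.le t) 0
      rw [h0]
      simp only [sub_zero]
      exact hz2
    · filter_upwards [hz1] with ω hω
      rw [sub_zero, Real.rpow_one] at hcρ
      rw [hcα]
      have := mul_le_mul_of_nonneg_left hω (div_nonneg hc hα.le)
      linarith
  · refine condExp_sub_le_const (ℱ.le t) hF hY ?_ (hQ c) (hpos hβ0) (.of_forall fun ω => ?_)
    · have hm := hL.measurable_regret (p := fun _ => θ₁) measurable_const θ₂
      refine .of_bound (C := (α * (2 * G) ^ 2) ^ (1 / β))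
        (((hm.pow_const 2).const_mul α).pow_const _).aestronglyMeasurable ?_
      filter_upwards [hL.ae_abs_pairing_le] with ω hb
      rw [Real.norm_of_nonneg (by positivity)]
      have h4 : pairing (grad (t + 1) ω θ₁) (θ₁ - θ₂) ^ 2 ≤ (2 * G) ^ 2 :=
        sq_le_sq' (by linarith [(abs_le.1 (hb θ₁ h₁ θ₂ h₂)).1]) (abs_le.1 (hb θ₁ h₁ θ₂ h₂)).2
      gcongr
    · have := mul_le_rpow_one_div_add (z := α * pairing (grad (t + 1) ω θ₁) (θ₁ - θ₂) ^ 2)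
        (by positivity) hρ hβ0 hβ1 hcρ
      rw [hcα]
      linarith

theorem averageRisk_ae_eq (hℓ : IsConvexLossSequence P ℱ ℓ grad) (hG : LipschitzLoss P grad G)
    {pred : ℕ → Ω → Param d} (hpred : ∀ t, Measurable[ℱ t] (pred t))
    (hball : ∀ t ω, pred t ω ∈ unitBall d) (T : ℕ) {θ : Param d} (hθ : θ ∈ unitBall d) :
    ∀ᵐ ω ∂P, averageRisk P ℱ ℓ pred T θ ω = 1 / (T : ℝ) * ∑ t ∈ Finset.range T,
      (P[fun ω' => ℓ (t + 1) ω' (pred t ω') - ℓ (t + 1) ω' θ | ℱ t]) ω := by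
  have h1 : ∀ t, ∀ᵐ ω ∂P,
      (P[fun ω' => ℓ (t + 1) ω' (pred t ω') - ℓ (t + 1) ω' θ | ℱ t]) ω =
      (P[fun ω' => ℓ (t + 1) ω' (pred t ω') | ℱ t]) ω -
        (P[fun ω' => ℓ (t + 1) ω' θ | ℱ t]) ω := by
    intro t
    have hL := hℓ.isLipschitzConvexLoss hG (t := t + 1) (by omega)
    exact condExp_sub (hL.integrable_comp ((hpred t).mono (ℱ.le t) le_rfl) (hball t))
      (hL.integrable θ hθ) _
  have h2 : ∀ f : ℕ → ℝ, ∑ t ∈ Finset.Icc 1 T, f t = ∑ t ∈ Finset.range T, f (t + 1) := by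
    intro f
    rw [Finset.range_eq_Ico, Finset.sum_Ico_add' f 0 T 1]
    exact Finset.sum_congr (by ext; simp) fun _ _ => rfl
  filter_upwards [ae_all_iff.2 h1] with ω h
  rw [averageRisk, h2, h2, ← mul_sub, ← Finset.sum_sub_distrib]
  simp only [Nat.add_sub_cancel, h]

theorem condExp_loss_sub_le (hℓ : IsConvexLossSequence P ℱ ℓ grad) (hG : LipschitzLoss P grad G)
    {p : Ω → Param d} {t : ℕ} (hp : Measurable[ℱ t] p)
    (hball : ∀ ω, p ω ∈ unitBall d) {θ : Param d} (hθ : θ ∈ unitBall d) {D : ℝ}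
    (hD : ∀ ω, ‖p ω - θ‖ ≤ D) :
    ∀ᵐ ω ∂P, (P[fun ω' => ℓ (t + 1) ω' (p ω') - ℓ (t + 1) ω' θ | ℱ t]) ω ≤ G * D := by
  have hL := hℓ.isLipschitzConvexLoss hG (t := t + 1) (by omega)
  refine condExp_le_const (ℱ.le t) ((hL.integrable_comp (hp.mono (ℱ.le t) le_rfl) hball).sub
    (hL.integrable θ hθ)) ?_
  filter_upwards [hL.subgradient, hL.norm_grad_le] with ω hsub hg
  have hG0 : 0 ≤ G := (norm_nonneg _).trans (hg θ hθ)
  exact (loss_sub_le hsub hg (hball ω)).trans (mul_le_mul_of_nonneg_left (hD ω) hG0)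

/-- This crude bound handles small `T`, and the regime `a ≥ T` of the second claim. -/
theorem averageRisk_le_two_mul (hℓ : IsConvexLossSequence P ℱ ℓ grad)
    (hG : LipschitzLoss P grad G) {pred : ℕ → Ω → Param d} (hpred : ∀ t, Measurable[ℱ t] (pred t))
    (hball : ∀ t ω, pred t ω ∈ unitBall d) {T : ℕ} (hT : 1 ≤ T) {θ : Param d}
    (hθ : θ ∈ unitBall d) : ∀ᵐ ω ∂P, averageRisk P ℱ ℓ pred T θ ω ≤ 2 * G := by
  have hT' : (0 : ℝ) < T := by exact_mod_cast hT
  filter_upwards [averageRisk_ae_eq hℓ hG hpred hball T hθ, ae_all_iff.2 fun t =>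
    condExp_loss_sub_le hℓ hG (hpred t) (hball t) hθ
      (fun ω => norm_sub_le_of_mem_unitBall (hball t ω) hθ)] with ω h1 h2
  rw [h1, one_div, inv_mul_le_iff₀ hT']
  calc _ ≤ ∑ t ∈ Finset.range T, G * 2 := Finset.sum_le_sum fun t _ => h2 t
    _ = _ := by rw [Finset.sum_const, Finset.card_range, nsmul_eq_mul]; ring

/-- The risk bound for a learning rate `η` of the grid, under a surrogate inequality. -/
theorem exists_event_averageRisk_le (hℓ : IsConvexLossSequence P ℱ ℓ grad)
    (hG : LipschitzLoss P grad G) (hG0 : 0 < G) {ε : NNReal} {Θ₀ : Finset (Param d)}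
    (hΘ : IsMinimalCover ε Θ₀) {N T i : ℕ} (hT : 1 ≤ T) (hi : 3 ≤ i) (hiN : i ≤ N) {δ : ℝ}
    (hδ : SurrogateBound P ℱ ℓ grad (3 * learningRate (4 * G / 3) i) δ) (x : ℝ) :
    ∃ A : Set Ω, MeasurableSet A ∧ 1 - Real.exp (-x) ≤ P.real A ∧ ∀ θ ∈ unitBall d,
      ∀ᵐ ω ∂P, ω ∈ A → averageRisk P ℱ ℓ (fun t ω' => squint Θ₀ (uniformPrior Θ₀) (4 * G / 3) N
        (fun s => grad s ω') t) T θ ω ≤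
        δ + G * ε + (Real.log (N * Θ₀.card) + Real.log Θ₀.card + x) /
          (learningRate (4 * G / 3) i * T) := by
  have hE : 0 < 4 * G / 3 := by positivity
  have hT' : (0 : ℝ) < T := by exact_mod_cast hT
  have hne := hΘ.nonempty
  have hN : 1 ≤ N := by omega
  have hK : (0 : ℝ) < Θ₀.card := by exact_mod_cast hne.card_pos
  have hprior : ∀ θ, 0 < uniformPrior Θ₀ θ := fun θ => by unfold uniformPrior; positivity
  set η := learningRate (4 * G / 3) i with hη
  have hη0 : 0 < η := learningRate_pos hE i
  have hrate : ∀ j, learningRate (4 * G / 3) j * (2 * G) = 3 / 2 * (Real.exp j)⁻¹ := fun j => by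
    unfold learningRate; field_simp; norm_num
  -- The largest rate gives `3 / (2 e) ≈ 0.552`, hence the range 0.56 in `exp_sub_sq_le_one_add`.
  have hrate1 : ∀ j, 1 ≤ j → learningRate (4 * G / 3) j * (2 * G) ≤ 56 / 100 := by
    intro j hj
    have h1 : Real.exp 1 ≤ Real.exp j := Real.exp_le_exp.2 (by exact_mod_cast hj)
    have h2 : (2.7 : ℝ) ≤ Real.exp j := by linarith [Real.exp_one_gt_d9]
    rw [hrate]
    calc 3 / 2 * (Real.exp j)⁻¹ ≤ 3 / 2 * (2.7)⁻¹ := by gcongr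
      _ ≤ 56 / 100 := by norm_num
  -- From index 3 on, `|η r| ≤ 1 / 10` and `3 η (2 G) ≤ 1 / 4`, as the supermartingale and the
  -- surrogate comparison require.
  have hrate3 : η * (2 * G) ≤ 8 / 100 := by
    have h1 : Real.exp 1 ^ 3 ≤ Real.exp i := by
      rw [← Real.exp_nat_mul]
      exact Real.exp_le_exp.2 (by rw [mul_one]; exact_mod_cast hi)
    have h2 : (2.7 : ℝ) ^ 3 ≤ Real.exp 1 ^ 3 := by
      gcongr; linarith [Real.exp_one_gt_d9]
    have h3 : (19 : ℝ) ≤ Real.exp i := by linarith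
    rw [hη, hrate]
    calc 3 / 2 * (Real.exp i)⁻¹ ≤ 3 / 2 * (19)⁻¹ := by gcongr
      _ ≤ 8 / 100 := by norm_num
  let pred : ℕ → Ω → Param d := fun t ω' => squint Θ₀ (uniformPrior Θ₀) (4 * G / 3) N
    (fun s => grad s ω') t
  have hpred : ∀ t, Measurable[ℱ t] (pred t) := measurable_squint hℓ.grad_adapted
  have hball : ∀ t ω, pred t ω ∈ unitBall d := fun t ω =>
    aggregate_mem_unitBall hne hΘ.1 hprior hE hN _
  let r : Param d → ℕ → Ω → ℝ := fun k t ω =>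
    instantRegret Θ₀ (uniformPrior Θ₀) (4 * G / 3) N (fun s => grad s ω) t k
  have hL : ∀ t, IsLipschitzConvexLoss P (ℓ (t + 1)) (grad (t + 1)) G := fun t =>
    hℓ.isLipschitzConvexLoss hG (by omega)
  have hr : ∀ᵐ ω ∂P, ∀ t, ∀ k ∈ Θ₀, |r k t ω| ≤ 2 * G := by
    filter_upwards [ae_all_iff.2 fun t => (hL t).ae_abs_pairing_le] with ω hω t k hk
    exact hω t _ (hball t ω) k (hΘ.1 hk)
  have hηr : ∀ k ∈ Θ₀, ∀ t, ∀ᵐ ω ∂P, |η * r k t ω| ≤ 1 / 10 := by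
    intro k hk t
    filter_upwards [hr] with ω hω
    rw [abs_mul, abs_of_pos hη0]
    linarith [mul_le_mul_of_nonneg_left (hω t k hk) hη0.le]
  let u : Param d → ℕ → Ω → ℝ := fun k t ω => η * r k t ω - 3 * (η * r k t ω) ^ 2
  let b : Param d → ℕ → Ω → ℝ := fun k t ω => η * r k t ω - (η * r k t ω) ^ 2
  have hrint : ∀ k ∈ Θ₀, ∀ t, Integrable (fun ω => r k t ω - 3 * η * r k t ω ^ 2) P :=
    fun k hk t => (hL t).integrable_regret_sub_sq ((hpred t).mono (ℱ.le t) le_rfl) (hball t)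
      (hΘ.1 hk) (3 * η)
  have hu_eq : ∀ k t, u k t = η • fun ω => r k t ω - 3 * η * r k t ω ^ 2 := by
    intro k t
    ext ω
    simp only [u, Pi.smul_apply, smul_eq_mul]
    ring
  have hbmeas : ∀ k ∈ Θ₀, ∀ t, Measurable[ℱ (t + 1)] (b k t) := by
    intro k _ t
    have h1 : Measurable[ℱ (t + 1)] (r k t) := measurable_instantRegret hℓ.grad_adapted t k
    exact (show Measurable fun y : ℝ => η * y - (η * y) ^ 2 by fun_prop).comp h1
  obtain ⟨A, hA, hPA, hAle⟩ := exists_event_sum_condExp_sub_le (ℱ := ℱ) hne (u := u) (b := b)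
    (B := 1) hbmeas (fun k hk t => by rw [hu_eq]; exact (hrint k hk t).smul η)
    (fun k hk t => by
      filter_upwards [hηr k hk t] with ω hω
      obtain ⟨h1, h2⟩ := abs_le.1 hω
      exact abs_le.2 ⟨by simp only [b]; nlinarith, by simp only [b]; nlinarith⟩)
    (fun k hk t => by
      filter_upwards [hηr k hk t] with ω hω
      obtain ⟨h1, h2⟩ := abs_le.1 hω
      exact abs_le.2 ⟨by simp only [u]; nlinarith, by simp only [u]; nlinarith⟩)
    (fun k hk t => by
      filter_upwards [hηr k hk t] with ω hω
      have := exp_neg_add_sq_le hω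
      simp only [u, b, neg_sub]
      rwa [neg_add_eq_sub] at this) T x
  refine ⟨A, hA, hPA, fun θ hθ => ?_⟩
  obtain ⟨k, hk, hkθ⟩ := hΘ.exists_norm_sub_le hθ
  have hkb := hΘ.1 hk
  -- The comparator is replaced by its neighbour `k` in the cover, at cost `G ε`; the surrogate for
  -- `k` is then `u k t` up to the factor `η`.
  have hround : ∀ t, ∀ᵐ ω ∂P,
      η * (P[fun ω' => ℓ (t + 1) ω' (pred t ω') - ℓ (t + 1) ω' θ | ℱ t]) ω ≤
        (P[u k t | ℱ t]) ω + η * (δ + G * ε) := by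
    intro t
    have hpint := (hL t).integrable_comp ((hpred t).mono (ℱ.le t) le_rfl) (hball t)
    have h1 := (hL t).condExp_surrogate_le (ℱ.le t) (c := 3 * η) (δ := δ) (by positivity)
      (by linarith) hkb (fun θ₁ h₁ => hδ t θ₁ h₁ k hkb) (hpred t) (hball t)
    have h2 := condExp_loss_sub_le hℓ hG (p := fun _ => k) (t := t) measurable_const
      (fun _ => hkb) hθ (fun _ => hkθ)
    have h3 := condExp_sub (hpint.sub ((hL t).integrable k hkb)) (hrint k hk t) (ℱ t)
    have h4 := condExp_add (hpint.sub ((hL t).integrable k hkb))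
      (((hL t).integrable k hkb).sub ((hL t).integrable θ hθ)) (ℱ t)
    have h5 := condExp_smul (μ := P) η (fun ω => r k t ω - 3 * η * r k t ω ^ 2) (ℱ t)
    rw [← hu_eq] at h5
    have h6 : (fun ω' => ℓ (t + 1) ω' (pred t ω') - ℓ (t + 1) ω' θ) =
        ((fun ω' => ℓ (t + 1) ω' (pred t ω')) - fun ω' => ℓ (t + 1) ω' k) +
        ((fun ω' => ℓ (t + 1) ω' k) - fun ω' => ℓ (t + 1) ω' θ) := by
      ext ω; simp
    filter_upwards [h1, h2, h3, h4, h5] with ω h1 h2 h3 h4 h5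
    rw [h6, h4, h5]
    simp only [Pi.add_apply, Pi.smul_apply, smul_eq_mul, Pi.sub_apply] at h3 ⊢
    have h7 := h3.symm.le.trans h1
    have h8 : (P[(fun ω' => ℓ (t + 1) ω' k) - fun ω' => ℓ (t + 1) ω' θ | ℱ t]) ω ≤ G * ε := h2
    rw [← mul_add]
    refine mul_le_mul_of_nonneg_left ?_ hη0.le
    linarith
  filter_upwards [averageRisk_ae_eq hℓ hG hpred hball T hθ, ae_all_iff.2 hround, hr]
    with ω h1 h2 h3 hωA
  change averageRisk P ℱ ℓ pred T θ ω ≤ _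
  have h4 := hAle ω hωA k hk
  have h5 := learningRate_mul_sum_instantRegret_le hne hE hN (fun s => grad s ω) T
    (fun t _ θ' hθ' j hj => by
      have h6 := learningRate_pos hE j
      rw [abs_mul, abs_of_pos h6]
      exact (mul_le_mul_of_nonneg_left (h3 t θ' hθ') h6.le).trans (hrate1 j hj))
    hk (Finset.mem_Icc.2 ⟨by omega, hiN⟩)
  have h6 : ∑ t ∈ Finset.range T, b k t ω ≤ Real.log (N * Θ₀.card) := h5
  rw [Finset.sum_sub_distrib] at h4
  have h7 := Finset.sum_le_sum fun t (_ : t ∈ Finset.range T) => h2 t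
  rw [← Finset.mul_sum, Finset.sum_add_distrib, Finset.sum_const, Finset.card_range,
    nsmul_eq_mul] at h7
  rw [h1, one_div, inv_mul_le_iff₀ hT']
  have h8 : T * (δ + G * ε + (Real.log (N * Θ₀.card) + Real.log Θ₀.card + x) / (η * T)) =
      (T * (η * (δ + G * ε)) + (Real.log (N * Θ₀.card) + Real.log Θ₀.card + x)) / η := by
    field_simp
  rw [h8, le_div_iff₀ hη0]
  linarith

end Risk

/-! ### Choice of the learning rate -/

theorem complexityTerm_ge {d T : ℕ} {G x : ℝ} (hGT : Real.exp 1 ≤ G * T) :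
    d * Real.log T + x ≤ complexityTerm d T G x := by
  have h1 : 1 ≤ Real.log (G * T) := (Real.le_log_iff_exp_le (by
    linarith [Real.exp_pos 1])).2 hGT
  have := Real.log_nonneg h1
  unfold complexityTerm
  linarith

theorem complexityTerm_pos {d T : ℕ} {G x : ℝ} (hT : 1 ≤ T) (hGT : Real.exp 1 ≤ G * T)
    (hx : 0 < x) : 0 < complexityTerm d T G x := by
  have h1 := complexityTerm_ge (d := d) (x := x) hGT
  have h2 : 0 ≤ d * Real.log T :=
    mul_nonneg (Nat.cast_nonneg d) (Real.log_nonneg (by exact_mod_cast hT))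
  linarith

theorem one_le_log_of_three_le {T : ℕ} (hT : 3 ≤ T) : 1 ≤ Real.log T := by
  have hT' : (3 : ℝ) ≤ T := by exact_mod_cast hT
  exact (Real.le_log_iff_exp_le (by linarith)).2 (by linarith [Real.exp_one_lt_d9])

/-- The logarithms of the number of experts are of the order of the complexity term. -/
theorem log_card_le_complexityTerm {d T N K : ℕ} {G x : ℝ} (hd : 1 ≤ d) (hT : 3 ≤ T)
    (hG : 0 < G) (hGT : Real.exp 1 ≤ G * T) (hx : 0 < x) (hN : 1 ≤ N)
    (hNle : (N : ℝ) ≤ Real.log (4 * G / 3 * (T : ℝ) ^ 2)) (hK : 1 ≤ K)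
    (hKle : (K : ℝ) ≤ (1 + 2 * (T : ℝ) ^ 2) ^ d) :
    Real.log (N * K) + Real.log K + x ≤ 11 * complexityTerm d T G x := by
  have hT' : (3 : ℝ) ≤ T := by exact_mod_cast hT
  have hT0 : (0 : ℝ) < T := by linarith
  have hd' : (1 : ℝ) ≤ d := by exact_mod_cast hd
  have hN' : (1 : ℝ) ≤ N := by exact_mod_cast hN
  have hK' : (1 : ℝ) ≤ K := by exact_mod_cast hK
  have hlogT := one_le_log_of_three_le hT
  have hu : 1 ≤ Real.log (G * T) := (Real.le_log_iff_exp_le (by positivity)).2 hGT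
  have hlogK : Real.log K ≤ 4 * (d * Real.log T) := by
    calc Real.log K ≤ Real.log (((T : ℝ) ^ 4) ^ d) := by
          refine Real.log_le_log (by linarith) (hKle.trans ?_)
          gcongr
          nlinarith [sq_nonneg ((T : ℝ) ^ 2), mul_self_nonneg ((T : ℝ) ^ 2 - 3)]
      _ = _ := by rw [Real.log_pow, Real.log_pow]; push_cast; ring
  have hlogN : Real.log N ≤ Real.log (Real.log (G * T)) + 2 * Real.log T := by
    have hv0 : (0 : ℝ) ≤ Real.log (4 / 3 * T) := Real.log_nonneg (by linarith)
    have hv1 : Real.log (4 / 3 * T) ≤ 2 * Real.log T := by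
      rw [Real.log_mul (by norm_num) hT0.ne', two_mul]
      gcongr
      linarith
    -- Since `log (G T) ≥ 1`, the sum is bounded by a product, whose logarithm isolates `log log (G
    -- T)`.
    have h1 : (N : ℝ) ≤ Real.log (G * T) * (1 + Real.log (4 / 3 * T)) := by
      calc (N : ℝ) ≤ Real.log (G * T * (4 / 3 * T)) := by
            refine hNle.trans_eq ?_; congr 1; ring
        _ = Real.log (G * T) + Real.log (4 / 3 * T) :=
            Real.log_mul (by positivity) (by positivity)
        _ ≤ _ := by nlinarith
    calc Real.log N ≤ Real.log (Real.log (G * T) * (1 + Real.log (4 / 3 * T))) :=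
          Real.log_le_log (by linarith) h1
      _ = Real.log (Real.log (G * T)) + Real.log (1 + Real.log (4 / 3 * T)) :=
          Real.log_mul (by linarith) (by linarith)
      _ ≤ _ := by
          have := Real.log_le_sub_one_of_pos (by linarith : 0 < 1 + Real.log (4 / 3 * T))
          linarith
  have hloglog := Real.log_nonneg hu
  have hdT : Real.log T ≤ d * Real.log T := le_mul_of_one_le_left (by linarith) hd'
  rw [Real.log_mul (by linarith) (by linarith)]
  unfold complexityTerm
  linarith

theorem learningRate_succ (E : ℝ) (i : ℕ) :
    Real.exp 1 * learningRate E (i + 1) = learningRate E i := by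
  unfold learningRate
  rw [Nat.cast_succ, Real.exp_add, mul_inv, mul_inv, mul_inv]
  field_simp

/-- The size of the grid of learning rates. -/
theorem grid_bounds {T N : ℕ} {G : ℝ} (hG : 0 < G) (hT : 256 ≤ T) (hGT : Real.exp 1 ≤ G * T)
    (hN : N = ⌊Real.log (4 * G / 3 * T)⌋₊ ∧ 1 ≤ G ^ 2 * T ∨
      N = ⌊Real.log (4 * G / 3 * (T : ℝ) ^ 2)⌋₊) :
    3 ≤ N ∧ (N : ℝ) ≤ Real.log (4 * G / 3 * (T : ℝ) ^ 2) ∧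
      G ^ 2 * T * learningRate (4 * G / 3) N ^ 2 ≤ 3 := by
  have hT' : (256 : ℝ) ≤ T := by exact_mod_cast hT
  have hT0 : (0 : ℝ) < T := by linarith
  have he1 := Real.exp_one_gt_d9
  have he2 := Real.exp_one_lt_d9
  -- `y` unifies the two choices of `N`; `21 > e³` provides three rates, and the last bound makes
  -- the smallest rate of order at most `1 / (G √T)`.
  obtain ⟨y, hNy, hy, hyT, hyG⟩ : ∃ y : ℝ, N = ⌊Real.log y⌋₊ ∧ 21 ≤ y ∧
      y ≤ 4 * G / 3 * (T : ℝ) ^ 2 ∧ 256 / 81 * (G ^ 2 * T) ≤ (4 * G / 3 * y) ^ 2 := by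
    rcases hN with ⟨hN, hGT1⟩ | hN
    · refine ⟨_, hN, ?_, ?_, ?_⟩
      · have h1 : 16 ≤ G * T := by
          refine le_of_sq_le_sq ?_ (by positivity)
          nlinarith
        linarith
      · gcongr
        exact le_self_pow₀ (by linarith) (by norm_num)
      · have : 0 ≤ G ^ 2 * T := by positivity
        nlinarith
    · refine ⟨_, hN, by nlinarith, le_rfl, ?_⟩
      have h1 : 1 ≤ (G * T) ^ 2 * T := one_le_mul_of_one_le_of_one_le
        (one_le_pow₀ (by linarith)) (by linarith)
      have : 0 ≤ G ^ 2 * T := by positivity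
      nlinarith
  have hy0 : 0 < y := by linarith
  have hlog3 : (3 : ℝ) ≤ Real.log y := by
    rw [Real.le_log_iff_exp_le hy0]
    calc Real.exp 3 = Real.exp 1 ^ 3 := by rw [← Real.exp_nat_mul]; norm_num
      _ ≤ 2.72 ^ 3 := by gcongr; linarith
      _ ≤ y := by linarith
  refine ⟨?_, ?_, ?_⟩
  · rw [hNy]; exact Nat.le_floor hlog3
  · rw [hNy]
    exact (Nat.floor_le (by linarith)).trans (Real.log_le_log hy0 hyT)
  · have h1 : y ≤ Real.exp 1 * Real.exp N := by
      have h2 := Nat.lt_floor_add_one (Real.log y)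
      rw [← hNy] at h2
      rw [← Real.exp_add, ← Real.log_le_iff_le_exp hy0]
      linarith
    have h3 : (4 * G / 3 * y) ^ 2 ≤ Real.exp 1 ^ 2 * (Real.exp N * (4 * G / 3)) ^ 2 := by
      rw [← mul_pow]
      gcongr ?_ ^ 2
      calc 4 * G / 3 * y ≤ 4 * G / 3 * (Real.exp 1 * Real.exp N) := by gcongr
        _ = _ := by ring
    have h4 : Real.exp 1 ^ 2 ≤ 2.72 ^ 2 := by gcongr; linarith
    have h5 : 0 < (Real.exp N * (4 * G / 3)) ^ 2 := by positivity
    unfold learningRate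
    rw [inv_pow, ← div_eq_mul_inv, div_le_iff₀ h5]
    nlinarith

/-- Consecutive rates differ by a factor `e`, so a target between two of them is met up to that
factor. -/
theorem exists_learningRate_near {E η : ℝ} {N : ℕ} (hN : 3 ≤ N) :
    learningRate E 3 ≤ η ∨
      (∃ i, 3 ≤ i ∧ i ≤ N ∧ learningRate E i ≤ η ∧ η ≤ Real.exp 1 * learningRate E i) ∨
      η ≤ learningRate E N := by
  by_cases h3 : learningRate E 3 ≤ η
  · exact .inl h3
  by_cases hNη : η ≤ learningRate E N
  · exact .inr (.inr hNη)
  right; left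
  classical
  have hex : ∃ i, 3 ≤ i ∧ learningRate E i ≤ η := ⟨N, hN, (not_le.1 hNη).le⟩
  obtain ⟨h1, h2⟩ := Nat.find_spec hex
  set i := Nat.find hex with hi
  refine ⟨i, h1, Nat.find_min' hex ⟨hN, (not_le.1 hNη).le⟩, h2, ?_⟩
  obtain ⟨j, hj⟩ : ∃ j, i = j + 1 := ⟨i - 1, by omega⟩
  have hj3 : 3 ≤ j := by
    rcases h1.eq_or_lt with h | h
    · rw [← h] at h2; exact absurd h2 h3
    · omega
  have hlt : ¬ (3 ≤ j ∧ learningRate E j ≤ η) := Nat.find_min hex (by omega)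
  rw [hj, learningRate_succ]
  exact (not_le.1 fun h => hlt ⟨hj3, h⟩).le

/-- The trade-off between the surrogate inequality and the regret bound. -/
theorem exists_learningRate_tradeoff {a α β G : ℝ} {T N : ℕ} (ha : 1 ≤ a) (hα : 0 < α)
    (hβ1 : β ≤ 1) (hG : 0 < G) (hT : 0 < (T : ℝ)) (hN : 3 ≤ N)
    (hgrid : G ^ 2 * T * learningRate (4 * G / 3) N ^ 2 ≤ 3) :
    ∃ i, 3 ≤ i ∧ i ≤ N ∧ ∃ δ, δ + 11 * a / (learningRate (4 * G / 3) i * T) ≤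
        308 * ((a / (α * T)) ^ (1 / (2 - β)) + G * a / T) ∧
      (3 * learningRate (4 * G / 3) i / α ≤ ((a / (α * T)) ^ (1 / (2 - β))) ^ (1 - β) ∧
        δ = (a / (α * T)) ^ (1 / (2 - β)) ∨
        δ = 4 * (3 * learningRate (4 * G / 3) i) * G ^ 2) := by
  have ha0 : 0 < a := by linarith
  have hq : 0 < a / (α * T) := by positivity
  set ρ := (a / (α * T)) ^ (1 / (2 - β)) with hρdef
  have hρ : 0 < ρ := Real.rpow_pos_of_pos hq _
  have hρpow : ρ * ρ ^ (1 - β) = a / (α * T) := by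
    rw [← Real.rpow_one_add' hρ.le (by linarith), hρdef, ← Real.rpow_mul hq.le]
    have : 1 / (2 - β) * (1 + (1 - β)) = 1 := by
      have : 2 - β ≠ 0 := by linarith
      field_simp; ring
    rw [this, Real.rpow_one]
  have hE : 0 < 4 * G / 3 := by positivity
  have hrate := learningRate_pos hE
  have he := Real.exp_one_lt_d9
  have hGa : 0 < G * a / T := by positivity
  -- As `ρ ^ (1 - β) = a / (α T ρ)`, this range of rates is exactly the one allowed by the Young
  -- step.
  have hκ : ∀ i, learningRate (4 * G / 3) i ≤ a / (3 * T * ρ) →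
      3 * learningRate (4 * G / 3) i / α ≤ ρ ^ (1 - β) := by
    intro i hi
    rw [le_div_iff₀ (by positivity)] at hi
    have h1 : ρ ^ (1 - β) = a / (α * T * ρ) := by
      rw [eq_div_iff (by positivity)]
      have := (eq_div_iff (by positivity : α * T ≠ 0)).1 hρpow
      linarith
    rw [h1, div_le_div_iff₀ hα (by positivity)]
    nlinarith
  rcases exists_learningRate_near (E := 4 * G / 3) (η := a / (3 * T * ρ)) hN with
    h | ⟨i, hi3, hiN, h1, h2⟩ | h
  -- The target exceeds the usable rates: `11 a / (η_3 T) = 11 e³ (4 / 3) G a / T`, the source of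
  -- the constant 308.
  · refine ⟨3, le_rfl, hN, ρ, ?_, .inl ⟨hκ 3 h, rfl⟩⟩
    have h1 : 11 * a / (learningRate (4 * G / 3) 3 * T) =
        11 * Real.exp 1 ^ 3 * (4 / 3) * (G * a / T) := by
      unfold learningRate
      rw [← Real.exp_nat_mul]
      push_cast
      rw [mul_one]
      field_simp
    have h2 : Real.exp 1 ^ 3 ≤ 2.72 ^ 3 := by gcongr; linarith
    rw [h1]
    nlinarith
  · refine ⟨i, hi3, hiN, ρ, ?_, .inl ⟨hκ i h1, rfl⟩⟩
    have h3 : 11 * a / (learningRate (4 * G / 3) i * T) ≤ 33 * Real.exp 1 * ρ := by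
      rw [div_le_iff₀ (by positivity)] at h2
      rw [div_le_iff₀ (mul_pos (hrate i) hT)]
      linarith
    nlinarith
  · refine ⟨N, hN, le_rfl, _, ?_, .inr rfl⟩
    set η := learningRate (4 * G / 3) N
    have hη : 0 < η := hrate N
    rw [div_le_iff₀ (by positivity)] at h
    have h3 : 11 * a / (η * T) ≤ 33 * ρ := by
      rw [div_le_iff₀ (by positivity)]
      linarith
    -- By `hgrid`, the left side times `η T` is at most 36, while `ρ η T ≥ a / 3 ≥ 1 / 3`.
    have h4 : 4 * (3 * η) * G ^ 2 ≤ 108 * ρ := by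
      have h5 : 4 * (3 * η) * G ^ 2 * (η * T) ≤ 108 * ρ * (η * T) := by nlinarith
      exact le_of_mul_le_mul_right h5 (by positivity)
    nlinarith

theorem mul_div_le_rpow {a α β G T : ℝ} (ha : 0 < a) (hα : 0 < α) (hβ1 : β ≤ 1)
    (hG : 0 < G) (hT : 0 < T) (h : α * G ^ (2 - β) ≤ 1) :
    G * (a / T) ^ (1 / (2 - β)) ≤ (a / (α * T)) ^ (1 / (2 - β)) := by
  have h2 : 0 < 2 - β := by linarith
  calc G * (a / T) ^ (1 / (2 - β)) = (G ^ (2 - β) * (a / T)) ^ (1 / (2 - β)) := by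
        rw [Real.mul_rpow (by positivity) (by positivity), ← Real.rpow_mul hG.le,
          mul_one_div_cancel h2.ne', Real.rpow_one]
    _ ≤ _ := by
        refine Real.rpow_le_rpow (by positivity) ?_ (by positivity)
        rw [mul_div_assoc', div_le_div_iff₀ hT (by positivity)]
        nlinarith [mul_pos ha hT]

/-- For `α G ^ (2 - β) ≤ 1` the term `G a / T` can be dropped. -/
theorem le_of_le_of_le_two_mul {R a α β G T : ℝ} (ha : 0 < a) (hα : 0 < α)
    (hβ1 : β ≤ 1) (hG : 0 < G) (hT : 0 < T) (h : α * G ^ (2 - β) ≤ 1)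
    (hR : R ≤ 308 * ((a / (α * T)) ^ (1 / (2 - β)) + G * a / T) + G / T ^ 2)
    (hR2 : R ≤ 2 * G) :
    R ≤ 131072 * ((a / (α * T)) ^ (1 / (2 - β)) + G / T ^ 2) := by
  have h1 := mul_div_le_rpow ha hα hβ1 hG hT h
  have h0 : 0 < 1 / (2 - β) := by
    have : 0 < 2 - β := by linarith
    positivity
  have hGT : 0 < G / T ^ 2 := by positivity
  have hρ : 0 < (a / (α * T)) ^ (1 / (2 - β)) := Real.rpow_pos_of_pos (by positivity) _
  -- If `a ≤ T`, then `a / T` is at most its power, as `1 / (2 - β) ≤ 1`; otherwise `2 G` is already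
  -- at most twice the main term.
  rcases le_total (a / T) 1 with haT | haT
  · have h2 : a / T ≤ (a / T) ^ (1 / (2 - β)) := by
      refine Real.self_le_rpow_of_le_one (by positivity) haT ?_
      rw [div_le_one (by linarith)]; linarith
    have h3 := mul_le_mul_of_nonneg_left h2 hG.le
    rw [← mul_div_assoc] at h3
    linarith
  · have h2 : 1 ≤ (a / T) ^ (1 / (2 - β)) := Real.one_le_rpow haT h0.le
    have h3 := mul_le_mul_of_nonneg_left h2 hG.le
    linarith

theorem averageRisk_eq_zero_of_dim_zero {Ω : Type*} {m0 : MeasurableSpace Ω} {P : Measure Ω}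
    {ℱ : Filtration ℕ m0} {ℓ : ℕ → Ω → Param 0 → ℝ} (pred : ℕ → Ω → Param 0) (T : ℕ)
    (θ : Param 0) (ω : Ω) : averageRisk P ℱ ℓ pred T θ ω = 0 := by
  have : pred = fun _ _ => θ := by
    ext t ω i; exact i.elim0
  simp [averageRisk, this]

end

/-! ### Assembly of the bounds -/

theorem proposition1 :
    ∃ C : ℝ, 0 < C ∧
      ∀ {Ω : Type*} {m0 : MeasurableSpace Ω} (P : Measure Ω) [IsProbabilityMeasure P]
        (ℱ : Filtration ℕ m0) (d : ℕ)
        (ℓ : ℕ → Ω → Param d → ℝ) (grad : ℕ → Ω → Param d → Fin d → ℝ)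
        (G α β x : ℝ) (T N : ℕ) (Θ₀ : Finset (Param d)),
        IsConvexLossSequence P ℱ ℓ grad →
        LipschitzLoss P grad G →
        0 < α → 0 ≤ β → β ≤ 1 →
        WeakExpConcave P ℱ ℓ grad α β →
        0 < x → 1 ≤ T → Real.exp 1 ≤ G * T →
        (N = ⌊Real.log (4 * G / 3 * T)⌋₊ ∧ 1 ≤ G ^ 2 * T ∨
          N = ⌊Real.log (4 * G / 3 * (T : ℝ) ^ 2)⌋₊) →
        IsMinimalCover (((T : NNReal) ^ 2)⁻¹) Θ₀ →
        ∃ A : Set Ω, MeasurableSet A ∧ 1 - 2 * Real.exp (-x) ≤ P.real A ∧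
          ∀ θ ∈ unitBall d,
            (∀ᵐ ω ∂P, ω ∈ A →
              averageRisk P ℱ ℓ
                  (fun t ω' => squint Θ₀ (uniformPrior Θ₀) (4 * G / 3) N
                    (fun s => grad s ω') t) T θ ω ≤
                C * ((complexityTerm d T G x / (α * T)) ^ (1 / (2 - β)) + G / (T : ℝ) ^ 2
                  + G * complexityTerm d T G x / T)) ∧
            (α * G ^ (2 - β) ≤ 1 → ∀ᵐ ω ∂P, ω ∈ A →
              averageRisk P ℱ ℓ
                  (fun t ω' => squint Θ₀ (uniformPrior Θ₀) (4 * G / 3) N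
                    (fun s => grad s ω') t) T θ ω ≤
                C * ((complexityTerm d T G x / (α * T)) ^ (1 / (2 - β)) + G / (T : ℝ) ^ 2)) := by
  -- This is `2 * 256²`: for `T < 256` the trivial bound `2 G` is then below `C G / T²`.
  refine ⟨131072, by norm_num, ?_⟩
  intro Ω m0 P _ ℱ d ℓ grad G α β x T N Θ₀ hℓ hG hα hβ hβ1 hwec hx hT hGT hN hΘ
  have hT0 : (0 : ℝ) < T := by exact_mod_cast hT
  have hG0 : 0 < G := pos_of_mul_pos_left ((Real.exp_pos 1).trans_le hGT) hT0.le
  have ha := complexityTerm_pos (d := d) hT hGT hx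
  have hρ : 0 < (complexityTerm d T G x / (α * T)) ^ (1 / (2 - β)) :=
    Real.rpow_pos_of_pos (by positivity) _
  have hGT2 : 0 < G / (T : ℝ) ^ 2 := by positivity
  have hGa : 0 < G * complexityTerm d T G x / T := by positivity
  have huniv : 1 - 2 * Real.exp (-x) ≤ P.real Set.univ := by
    rw [probReal_univ]; linarith [Real.exp_pos (-x)]
  -- In dimension zero the risk vanishes; otherwise `d log T` dominates `log T`, so the complexity
  -- term is at least 1 for `T ≥ 3`.
  rcases Nat.eq_zero_or_pos d with rfl | hd
  · refine ⟨Set.univ, .univ, huniv, fun θ _ => ⟨.of_forall fun ω _ => ?_,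
      fun _ => .of_forall fun ω _ => ?_⟩⟩ <;>
    · rw [averageRisk_eq_zero_of_dim_zero]
      positivity
  have hE : 0 < 4 * G / 3 := by positivity
  have hN1 : 1 ≤ N := by
    have h1 : 1 ≤ Real.log (4 * G / 3 * T) := by
      rw [Real.le_log_iff_exp_le (by positivity)]
      linarith [Real.exp_pos 1]
    rcases hN with ⟨hN, -⟩ | hN
    · rw [hN]; exact Nat.le_floor (by exact_mod_cast h1)
    · rw [hN]
      refine Nat.le_floor ?_
      rw [Nat.cast_one]
      refine h1.trans (Real.log_le_log (by positivity) ?_)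
      gcongr
      exact le_self_pow₀ (by exact_mod_cast hT) (by norm_num)
  have hK := hΘ.nonempty.card_pos
  have hprior : ∀ θ, 0 < uniformPrior Θ₀ θ := fun θ => by
    have : (0 : ℝ) < Θ₀.card := by exact_mod_cast hK
    unfold uniformPrior; positivity
  have htriv : ∀ θ ∈ unitBall d, ∀ᵐ ω ∂P, averageRisk P ℱ ℓ
      (fun t ω' => squint Θ₀ (uniformPrior Θ₀) (4 * G / 3) N (fun s => grad s ω') t) T θ ω ≤
        2 * G := fun θ hθ =>
    averageRisk_le_two_mul hℓ hG (measurable_squint hℓ.grad_adapted)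
      (fun t ω => aggregate_mem_unitBall hΘ.nonempty hΘ.1 hprior hE hN1 _) hT hθ
  rcases lt_or_ge T 256 with hT256 | hT256
  · have hsmall : 2 * G ≤ 131072 * (G / (T : ℝ) ^ 2) := by
      have h1 : (T : ℝ) ≤ 256 := by exact_mod_cast hT256.le
      rw [mul_div_assoc', le_div_iff₀ (by positivity)]
      nlinarith [pow_le_pow_left₀ hT0.le h1 2]
    refine ⟨Set.univ, .univ, huniv, fun θ hθ => ⟨?_, fun _ => ?_⟩⟩ <;>
    · filter_upwards [htriv θ hθ] with ω hω _
      linarith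
  obtain ⟨hN3, hNle, hgrid⟩ := grid_bounds hG0 hT256 hGT hN
  have ha1 : 1 ≤ complexityTerm d T G x := by
    have h1 := complexityTerm_ge (d := d) (x := x) hGT
    have h2 := one_le_log_of_three_le (T := T) (by omega)
    have h3 : (1 : ℝ) ≤ d := by exact_mod_cast hd
    nlinarith
  obtain ⟨i, hi3, hiN, δ, hδ, hcase⟩ :=
    exists_learningRate_tradeoff ha1 hα hβ1 hG0 hT0 hN3 hgrid
  have hη := learningRate_pos hE i
  have hsur : SurrogateBound P ℱ ℓ grad (3 * learningRate (4 * G / 3) i) δ := by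
    rcases hcase with ⟨h1, rfl⟩ | rfl
    · exact .of_weakExpConcave hℓ hG hα hβ hβ1 hwec (by positivity) hρ h1
    · exact .of_convex hℓ hG (by positivity)
  obtain ⟨A, hA, hPA, hbound⟩ := exists_event_averageRisk_le hℓ hG hG0 hΘ hT hi3 hiN hsur x
  have hlog := log_card_le_complexityTerm (by omega) (by omega) hG0 hGT hx hN1 hNle hK
    (hΘ.card_le hT)
  have hmain : ∀ θ ∈ unitBall d, ∀ᵐ ω ∂P, ω ∈ A → averageRisk P ℱ ℓ
      (fun t ω' => squint Θ₀ (uniformPrior Θ₀) (4 * G / 3) N (fun s => grad s ω') t) T θ ω ≤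
      308 * ((complexityTerm d T G x / (α * T)) ^ (1 / (2 - β)) +
        G * complexityTerm d T G x / T) + G / (T : ℝ) ^ 2 := by
    intro θ hθ
    filter_upwards [hbound θ hθ] with ω hω hωA
    have h1 := hω hωA
    have h2 := div_le_div_of_nonneg_right hlog (mul_pos hη hT0).le
    have h3 : G * ((((T : NNReal) ^ 2)⁻¹ : NNReal) : ℝ) = G / (T : ℝ) ^ 2 := by
      push_cast; rw [div_eq_mul_inv]
    rw [h3] at h1
    linarith
  refine ⟨A, hA, by linarith [Real.exp_pos (-x)], fun θ hθ => ⟨?_, fun hαG => ?_⟩⟩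
  · filter_upwards [hmain θ hθ] with ω hω hωA
    have := hω hωA
    linarith
  · filter_upwards [hmain θ hθ, htriv θ hθ] with ω hω h2 hωA
    exact le_of_le_of_le_two_mul ha hα hβ1 hG0 hT0 hαG (hω hωA) h2
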